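/- Consider a matching model with finite sets $\mathcal D$ of demand classes and $\mathcal S$ of supply classes, a set $\mathcal E\subset\mathcal D\times\mathcal S$ of matching pairs such that the bipartite graph $(\mathcal D\cup\mathcal S,\mathcal E)$ is connected, and a set $\mathcal A\subset\mathcal D\times\mathcal S$ of arrival pairs. Write $\ell=|\mathcal D|+|\mathcal S|$, let $1^k\in\mathbb Z_+^\ell$ be the unit vector of class $k$, and put $\mathsf Q=\{q\in\mathbb Z_+^\ell:\sum_{i\in\mathcal D}q_i=\sum_{j\in\mathcal S}q_j\}$, $\mathsf A=\{1^i+1^j:(i,j)\in\mathcal A\}$. The arrivals $A(t)$ are i.i.d. with values in $\mathsf A$ (with $A(0)$ a given initial condition), and $\alpha=\mathsf E[A(t)]$ for $t\ge1$. The buffer levels $Q(t)\in\mathsf Q$ evolve as $Q(t+1)=Q(t)-U(t)+A(t)$, where the input $U(t)$ is a sum of at most $\bar n_u$ vectors $1^i+1^j$, $(i,j)\in\mathcal E$ (with repetition), and $U(t)\le Q(t)+A(t)$ componentwise; here $\bar n_u\ge4$ is a fixed integer. Let $X(t)=Q(t)+A(t)$, so that $X(t+1)=X(t)-U(t)+A(t+1)$,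 and let $c(x)=\sum_k c_kx_k$ with all $c_k>0$. The average cost of a policy is $\limsup_{N\to\infty}\frac1N\sum_{t=0}^{N-1}\mathsf E[c(X(t))]$, and the optimal average cost from an initial condition is its infimum over all non-anticipative, possibly randomized, policies. Two MDPs are considered: one with state process $Y(t)=(Q(t),A(t))\in\mathsf Q\times\mathsf A$, in which $U(t)$ may depend on $Y(0),\dots,Y(t)$, and one with state process $X(t)\in\mathsf Q$, in which $U(t)$ may depend on $X(0),\dots,X(t)$. Assume NCond: for all non-empty $D\subsetneq\mathcal D$ and $S\subsetneq\mathcal S$, $$\sum_{i\in D}\alpha_i<\sum_{j\in\mathcal S(D)}\alpha_j\quad\text{and}\quad\sum_{j\in S}\alpha_j<\sum_{i\in\mathcal D(S)}\alpha_i,$$ where $\mathcal S(D)$ is the set of supply classes that can be matched with some class in $D$, and $\mathcal D(S)$ the set of demand classes that can be matched with some class in $S$. Then there are finite constants $\eta^*_Y$ and $\eta^*$ such that, from every initial condition, the optimal average cost is $\eta^*_Y$ for the MDP with state $Y$ and $\eta^*$ for the MDP with state $X$. For each of the two MDPs some stationary policy, $U(t)=\psi(Y(t))$ respectively $U(t)=\phi(X(t))$,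 attains the optimal average cost from every initial condition. Moreover, $\eta^*_Y=\eta^*$. -/

import Mathlib

open Filter
open scoped NNReal ENNReal

universe u v w

set_option linter.unusedSectionVars false

/-! ### Markov decision processes on a discrete state space, average cost -/

/-- A discrete-time Markov decision process with nonnegative one-stage cost: a state space, the
set of admissible inputs in each state, the transition law, and the cost of a state. -/
structure MDP where
  State : Type w
  Act : State → Type w
  trans : (x : State) → Act x → PMF State
  cost : State → ℝ≥0∞

namespace MDP

/-- A (possibly randomized) non-anticipative policy: the conditional law of the input at time `t`
is a function of the past states (most recent first) and of the present state. -/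
def Policy (M : MDP.{w}) : Type w :=
  List M.State → (x : M.State) → PMF (M.Act x)

/-- The policy that applies the state feedback law `φ` at all times. -/
noncomputable def stationary (M : MDP.{w}) (φ : (x : M.State) → M.Act x) : M.Policy :=
  fun _ x => PMF.pure (φ x)

/-- The joint law of the past `X (t-1), …, X 0` and of the present state `X t`, for the process
controlled by `π` and started at `X 0 = x`. -/
noncomputable def histLaw (M : MDP.{w}) (π : M.Policy) (x : M.State) :
    ℕ → PMF (List M.State × M.State)
  | 0 => PMF.pure ([], x)
  | t + 1 => (histLaw M π x t).bind fun h =>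
      (π h.1 h.2).bind fun a => (M.trans h.2 a).map fun y => (h.2 :: h.1, y)

/-- The expected cost at time `t`. -/
noncomputable def expCost (M : MDP.{w}) (π : M.Policy) (x : M.State) (t : ℕ) : ℝ≥0∞ :=
  ∑' h : List M.State × M.State, M.histLaw π x t h * M.cost h.2

/-- The average cost `limsup_N (1/N) ∑_{t<N} E[cost (X t)]` of the policy `π` from `x`. -/
noncomputable def avgCost (M : MDP.{w}) (π : M.Policy) (x : M.State) : ℝ≥0∞ :=
  limsup (fun N : ℕ => (∑ t ∈ Finset.range N, M.expCost π x t) / (N : ℝ≥0∞)) atTop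

/-- The optimal average cost from `x`: the infimum over all non-anticipative policies. -/
noncomputable def optCost (M : MDP.{w}) (x : M.State) : ℝ≥0∞ :=
  ⨅ π : M.Policy, M.avgCost π x

/-- The optimal average cost exists and is the finite constant `η`: from every initial state the
optimal average cost is `η`, and a single stationary policy achieves it from all of them. -/
def HasOptimalAverageCost (M : MDP.{w}) (η : ℝ≥0) : Prop :=
  (∀ x : M.State, M.optCost x = η) ∧
    ∃ φ : (x : M.State) → M.Act x, ∀ x : M.State, M.avgCost (M.stationary φ) x = η

end MDP

/-! ### The bipartite matching model -/

/-- The vector with one unit in demand class `e.1` and one unit in supply class `e.2`. -/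
def pairVec {D : Type u} {S : Type v} [DecidableEq D] [DecidableEq S] (e : D × S) : D ⊕ S → ℕ :=
  Pi.single (Sum.inl e.1) 1 + Pi.single (Sum.inr e.2) 1

/-- The data of a matching model with demand classes `D` and supply classes `S`. -/
structure MatchingModel (D : Type u) (S : Type v) where
  /-- the matching pairs -/
  edges : Finset (D × S)
  /-- the arrival pairs -/
  arrivals : Finset (D × S)
  /-- the law of the pair that arrives in a time slot -/
  law : PMF {e // e ∈ arrivals}
  /-- the maximal number of matches in a time slot -/
  maxMatches : ℕ
  /-- the coefficients of the linear cost function -/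
  c : D ⊕ S → ℝ

/-- Buffer levels with total demand equal to total supply. -/
def BalancedState (D : Type u) (S : Type v) [Fintype D] [Fintype S] : Type (max u v) :=
  {q : D ⊕ S → ℕ // ∑ i : D, q (Sum.inl i) = ∑ j : S, q (Sum.inr j)}

namespace MatchingModel

variable {D : Type u} {S : Type v}

/-- The matching graph. -/
def graph (M : MatchingModel D S) : SimpleGraph (D ⊕ S) where
  Adj k l := ∃ e ∈ M.edges,
    (k = Sum.inl e.1 ∧ l = Sum.inr e.2) ∨ (k = Sum.inr e.2 ∧ l = Sum.inl e.1)
  symm := ⟨by rintro k l ⟨e, he, h | h⟩ <;> exact ⟨e, he, by tauto⟩⟩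
  loopless := ⟨by rintro k ⟨e, he, ⟨h, h'⟩ | ⟨h, h'⟩⟩ <;> simp [h] at h'⟩

variable [Fintype D] [Fintype S] [DecidableEq D] [DecidableEq S]

/-- The supply classes that can be matched with some class in `B`. -/
def supplyOf (M : MatchingModel D S) (B : Finset D) : Finset S :=
  Finset.univ.filter fun j => ∃ i ∈ B, (i, j) ∈ M.edges

/-- The demand classes that can be matched with some class in `B`. -/
def demandOf (M : MatchingModel D S) (B : Finset S) : Finset D :=
  Finset.univ.filter fun i => ∃ j ∈ B, (i, j) ∈ M.edges

/-- The mean arrival rate `α k = E[A_k(t)]`. -/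
noncomputable def rate (M : MatchingModel D S) (k : D ⊕ S) : ℝ :=
  ∑ e : {e // e ∈ M.arrivals}, (M.law e).toReal * (pairVec e.1 k : ℝ)

/-- The stabilizability condition. -/
def NCond (M : MatchingModel D S) : Prop :=
  (∀ B : Finset D, B.Nonempty → B ≠ Finset.univ →
    ∑ i ∈ B, M.rate (Sum.inl i) < ∑ j ∈ M.supplyOf B, M.rate (Sum.inr j)) ∧
  (∀ B : Finset S, B.Nonempty → B ≠ Finset.univ →
    ∑ j ∈ B, M.rate (Sum.inr j) < ∑ i ∈ M.demandOf B, M.rate (Sum.inl i))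

/-- The finite input space: combinations of at most `maxMatches` single matches. -/
def inputSpace (M : MatchingModel D S) : Set (D ⊕ S → ℕ) :=
  {y | ∃ n : D × S → ℕ, ∑ e ∈ M.edges, n e ≤ M.maxMatches ∧
    y = ∑ e ∈ M.edges, n e • pairVec e}

/-- The inputs that are feasible when the items present are `x`. -/
def Input (M : MatchingModel D S) (x : BalancedState D S) : Type (max u v) :=
  {y : D ⊕ S → ℕ // y ∈ M.inputSpace ∧ y ≤ x.1}

theorem sum_inl_pairVec (e : D × S) : ∑ i : D, pairVec e (Sum.inl i) = 1 := by
  simp [pairVec, Pi.single_apply]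

theorem sum_inr_pairVec (e : D × S) : ∑ j : S, pairVec e (Sum.inr j) = 1 := by
  simp [pairVec, Pi.single_apply]

theorem inputSpace_balanced (M : MatchingModel D S) {y : D ⊕ S → ℕ} (hy : y ∈ M.inputSpace) :
    ∑ i : D, y (Sum.inl i) = ∑ j : S, y (Sum.inr j) := by
  obtain ⟨n, -, rfl⟩ := hy
  simp only [Finset.sum_apply, Pi.smul_apply, smul_eq_mul]
  rw [Finset.sum_comm, Finset.sum_comm (s := (Finset.univ : Finset S))]
  simp only [← Finset.mul_sum, sum_inl_pairVec, sum_inr_pairVec]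

/-- Remove the matched items: `x - y`, where `y ≤ x`. -/
def remove (M : MatchingModel D S) (x : BalancedState D S) (y : M.Input x) : BalancedState D S :=
  ⟨fun k => x.1 k - y.1 k, by
    have h1 := M.inputSpace_balanced y.2.1
    have h2 := x.2
    rw [Finset.sum_tsub_distrib _ (fun i _ => y.2.2 (Sum.inl i)),
      Finset.sum_tsub_distrib _ (fun j _ => y.2.2 (Sum.inr j)), h1, h2]⟩

/-- Add an arriving pair. -/
def arrive (q : BalancedState D S) (e : D × S) : BalancedState D S :=
  ⟨q.1 + pairVec e, by
    simp only [Pi.add_apply, Finset.sum_add_distrib, sum_inl_pairVec, sum_inr_pairVec, q.2]⟩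

/-- The linear cost `c x = ∑ c_k x_k`. -/
noncomputable def linCost (M : MatchingModel D S) (x : BalancedState D S) : ℝ≥0∞ :=
  ENNReal.ofReal (∑ k, M.c k * (x.1 k : ℝ))

/-- The MDP with state process `X`, with `X(t+1) = X(t) - U(t) + A(t+1)`. -/
noncomputable def mdpX (M : MatchingModel D S) : MDP.{max u v} where
  State := BalancedState D S
  Act x := M.Input x
  trans x y := M.law.map fun a => arrive (M.remove x y) a.1
  cost x := M.linCost x

/-- The MDP with state process `Y = (Q, A)`, with `Q(t+1) = Q(t) - U(t) + A(t)` and the cost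
evaluated at `X(t) = Q(t) + A(t)`. -/
noncomputable def mdpY (M : MatchingModel D S) : MDP.{max u v} where
  State := BalancedState D S × {e // e ∈ M.arrivals}
  Act s := M.Input (arrive s.1 s.2.1)
  trans s y := M.law.map fun a => (M.remove (arrive s.1 s.2.1) y, a)
  cost s := M.linCost (arrive s.1 s.2.1)

end MatchingModel

/-! The argument is the vanishing discount method, run on the buffer level left after matching.
Arrivals are i.i.d., so the optimal cost-to-go after a decision depends only on this level `q`. In
both MDPs the items present determine the cost, the feasible levels `q` and the law of the next
items. Both therefore lead to the same control problem: from `q` an arrival is observed, then a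
successor is chosen in a finite set.

For discount `r < 1` value iteration converges to a fixed point `W`. Two facts bound the oscillation
of `W` uniformly in `r`: a Lyapunov function `w` for one particular policy (`exists_lyapunov`), and
the possibility of steering from any level to any other with positive probability (`reachable`).
Limits of `(1 - r) * min W` and of `W - min W` as `r → 1` solve the average cost optimality equation
(`exists_average_cost_optimality`).

A minimizing stationary policy costs at most `η`, by telescoping (`MDP.avgCost_stationary_le`).
Conversely, an arbitrary policy with average cost below `η'` has discounted cost at most `C + η' /
(1 - r)` by Abel summation. This dominates the discounted values, and letting `r → 1` yields `η ≤
η'` (`MDP.hasOptimalAverageCost_of_discounted`).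

`NCond` enters twice. Applied to level sets of `q` it makes the quadratic function decrease when
every arriving item is matched with its longest neighboring queue (`exists_negative_drift`). Through
Hall's theorem it also turns a large proportional batch of arrivals into a sum of matches
(`exists_arrivals_eq_matches`), which gives reachability. -/

/-! ### Vanishing discount for a control problem with finite noise and finite choice sets -/

namespace FiniteControl

variable {Q A : Type*} [Fintype A]

/-- The discounted Bellman operator: the noise `a` is observed first, then the next state is
chosen in the finite set `N q a`. -/
noncomputable def bellman (p : A → ℝ) (N : Q → A → Finset Q) (hN : ∀ q a, (N q a).Nonempty)
    (κ : Q → ℝ) (r : ℝ) (f : Q → ℝ) (q : Q) : ℝ :=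
  κ q + r * ∑ a, p a * (N q a).inf' (hN q a) f

/-- Value iteration from the zero function. -/
noncomputable def valueIter (p : A → ℝ) (N : Q → A → Finset Q) (hN : ∀ q a, (N q a).Nonempty)
    (κ : Q → ℝ) (r : ℝ) : ℕ → Q → ℝ
  | 0 => 0
  | n + 1 => bellman p N hN κ r (valueIter p N hN κ r n)

variable {p : A → ℝ} {N : Q → A → Finset Q} {hN : ∀ q a, (N q a).Nonempty} {κ : Q → ℝ} {r : ℝ}

theorem inf'_sub_const {s : Finset Q} (hs : s.Nonempty) (f : Q → ℝ) (c : ℝ) :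
    s.inf' hs (fun q => f q - c) = s.inf' hs f - c := by
  apply le_antisymm
  · rw [le_sub_iff_add_le]
    refine Finset.le_inf' _ _ fun b hb => ?_
    have : s.inf' hs (fun q => f q - c) ≤ f b - c := Finset.inf'_le (fun q => f q - c) hb
    linarith
  · exact Finset.le_inf' _ _ fun b hb => sub_le_sub_right (Finset.inf'_le f hb) c

theorem bellman_mono (hp : ∀ a, 0 ≤ p a) (hr : 0 ≤ r) {f g : Q → ℝ} (h : f ≤ g) :
    bellman p N hN κ r f ≤ bellman p N hN κ r g := fun q => by
  unfold bellman
  gcongr with a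
  · exact hp a
  · exact h _

theorem bellman_nonneg (hp : ∀ a, 0 ≤ p a) (hκ : ∀ q, 0 ≤ κ q) (hr : 0 ≤ r) {f : Q → ℝ}
    (h : 0 ≤ f) : 0 ≤ bellman p N hN κ r f := fun q => by
  have : ∀ a, 0 ≤ (N q a).inf' (hN q a) f := fun a => Finset.le_inf' _ _ fun b _ => h b
  exact add_nonneg (hκ q)
    (mul_nonneg hr (Finset.sum_nonneg fun a _ => mul_nonneg (hp a) (this a)))

theorem bellman_le_of_selection (hp : ∀ a, 0 ≤ p a) (hr : 0 ≤ r) {f : Q → ℝ} {q : Q}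
    {s : A → Q} (hs : ∀ a, s a ∈ N q a) :
    bellman p N hN κ r f q ≤ κ q + r * ∑ a, p a * f (s a) := by
  unfold bellman
  gcongr with a
  · exact hp a
  · exact Finset.inf'_le f (hs a)

theorem valueIter_nonneg (hp : ∀ a, 0 ≤ p a) (hκ : ∀ q, 0 ≤ κ q) (hr : 0 ≤ r) (n : ℕ) :
    0 ≤ valueIter p N hN κ r n := by
  induction n with
  | zero => exact le_rfl
  | succ n ih => exact bellman_nonneg hp hκ hr ih

theorem valueIter_monotone (hp : ∀ a, 0 ≤ p a) (hκ : ∀ q, 0 ≤ κ q) (hr : 0 ≤ r) :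
    Monotone (valueIter p N hN κ r) := by
  refine monotone_nat_of_le_succ fun n => ?_
  induction n with
  | zero => exact valueIter_nonneg hp hκ hr 1
  | succ n ih => exact bellman_mono hp hr ih

/-- Bounded value iteration converges to a fixed point of the Bellman operator. -/
theorem exists_tendsto_valueIter (hp : ∀ a, 0 ≤ p a) (hκ : ∀ q, 0 ≤ κ q) (hr : 0 ≤ r)
    {b : Q → ℝ} (hb : ∀ n, valueIter p N hN κ r n ≤ b) :
    ∃ W : Q → ℝ, (∀ q, Tendsto (fun n => valueIter p N hN κ r n q) atTop (nhds (W q))) ∧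
      (∀ n, valueIter p N hN κ r n ≤ W) ∧ bellman p N hN κ r W = W := by
  have hbdd : ∀ q, BddAbove (Set.range fun n => valueIter p N hN κ r n q) := fun q =>
    ⟨b q, by rintro _ ⟨n, rfl⟩; exact hb n q⟩
  have hmono : ∀ q, Monotone fun n => valueIter p N hN κ r n q := fun q m n h =>
    valueIter_monotone hp hκ hr h q
  have hlim := fun q => tendsto_atTop_ciSup (hmono q) (hbdd q)
  refine ⟨fun q => ⨆ n, valueIter p N hN κ r n q, hlim, fun n q => le_ciSup (hbdd q) n, ?_⟩
  funext q
  have h1 : Tendsto (fun n => valueIter p N hN κ r (n + 1) q) atTop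
      (nhds (bellman p N hN κ r (fun q => ⨆ n, valueIter p N hN κ r n q) q)) := by
    refine tendsto_const_nhds.add (tendsto_const_nhds.mul (tendsto_finsetSum _ fun a _ =>
      tendsto_const_nhds.mul ?_))
    exact Tendsto.finset_inf'_nhds_apply (hN q a) fun b _ => hlim b
  exact tendsto_nhds_unique h1 ((tendsto_add_atTop_iff_nat 1).2 (hlim q))

/-! ### Bounds on the discounted values and the limit as the discount factor tends to one. -/

section Lyapunov

variable {w : Q → ℝ} {K : ℝ} {s : Q → A → Q}

/-- One copy of `κ` in the drift pays the running cost, the other is discarded; the constants `K`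
add up to a geometric series. -/
theorem valueIter_le_lyapunov (hp : ∀ a, 0 ≤ p a) (hp1 : ∑ a, p a = 1) (hκ : ∀ q, 0 ≤ κ q)
    (hr : 0 ≤ r) (hr1 : r < 1) (hw : ∀ q, 0 ≤ w q) (hs : ∀ q a, s q a ∈ N q a)
    (hdrift : ∀ q, ∑ a, p a * w (s q a) ≤ w q - 2 * κ q + K) (n : ℕ) (hK : 0 ≤ K) :
    valueIter p N hN κ r n ≤ fun q => w q + K / (1 - r) := by
  have h1 : 0 < 1 - r := by linarith
  induction n with
  | zero => exact fun q => add_nonneg (hw q) (by positivity)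
  | succ n ih =>
    intro q
    refine (bellman_mono hp hr ih q).trans ((bellman_le_of_selection hp hr (hs q)).trans ?_)
    simp only [mul_add, Finset.sum_add_distrib, ← Finset.sum_mul, hp1, one_mul]
    have h2 : 0 ≤ ∑ a, p a * w (s q a) :=
      Finset.sum_nonneg fun a _ => mul_nonneg (hp a) (hw _)
    have h3 : r * ∑ a, p a * w (s q a) ≤ ∑ a, p a * w (s q a) := by nlinarith
    have h4 : K / (1 - r) - r * (K / (1 - r)) = K := by field_simp
    linarith [hdrift q, hκ q]

/-- Outside the sublevel set the second copy of `κ` absorbs `K`, so `w` alone pays for the way to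
that set. No factor `1 / (1 - r)` appears, and this is what survives the limit `r → 1`. -/
theorem valueIter_le_of_le_on_sublevel (hp : ∀ a, 0 ≤ p a) (hp1 : ∑ a, p a = 1)
    (hr : 0 ≤ r) (hr1 : r < 1) (hw : ∀ q, 0 ≤ w q) (hs : ∀ q a, s q a ∈ N q a)
    (hdrift : ∀ q, ∑ a, p a * w (s q a) ≤ w q - 2 * κ q + K) {m : ℝ} (hm : 0 ≤ m)
    (hF : ∀ n q, κ q ≤ K → valueIter p N hN κ r n q ≤ m) (n : ℕ) :
    valueIter p N hN κ r n ≤ fun q => w q + m := by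
  induction n with
  | zero => exact fun q => add_nonneg (hw q) hm
  | succ n ih =>
    intro q
    rcases le_or_gt (κ q) K with h | h
    · exact (hF _ q h).trans (le_add_of_nonneg_left (hw q))
    refine (bellman_mono hp hr ih q).trans ((bellman_le_of_selection hp hr (hs q)).trans ?_)
    simp only [mul_add, Finset.sum_add_distrib, ← Finset.sum_mul, hp1, one_mul]
    have h2 : 0 ≤ ∑ a, p a * w (s q a) :=
      Finset.sum_nonneg fun a _ => mul_nonneg (hp a) (hw _)
    have h3 : r * ∑ a, p a * w (s q a) ≤ ∑ a, p a * w (s q a) := by nlinarith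
    have h4 : r * m ≤ m := by nlinarith
    linarith [hdrift q]

/-- Along a path of positive probability a subsolution is controlled by its value at the end point,
up to a constant that does not depend on the subsolution. -/
theorem exists_le_of_reachable (hp : ∀ a, 0 ≤ p a) (hp1 : ∑ a, p a = 1)
    (hκ : ∀ q, 0 ≤ κ q) (hw : ∀ q, 0 ≤ w q)
    (hs : ∀ q a, s q a ∈ N q a) {q q' : Q}
    (h : Relation.ReflTransGen (fun x y => ∃ a, 0 < p a ∧ y ∈ N x a) q q') :
    ∃ C P : ℝ, 0 ≤ C ∧ 0 < P ∧ ∀ (f : Q → ℝ) (m : ℝ),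
      (∀ x, f x ≤ bellman p N hN κ 1 f x) → (∀ x, f x ≤ w x + m) →
      f q ≤ C + P * f q' + (1 - P) * m := by
  classical
  induction h using Relation.ReflTransGen.head_induction_on with
  | refl => exact ⟨0, 1, le_rfl, one_pos, fun f m _ _ => by simp⟩
  | head hstep _ ih =>
    rename_i x y _
    obtain ⟨a, ha, hy⟩ := hstep
    obtain ⟨C, P, hC, hP, ih⟩ := ih
    -- `P` is the probability of the noise sequence along the path. For any other noise the
    -- selection `s` is followed and `f` is bounded by `w + m`.
    refine ⟨κ x + ∑ b, p b * w (s x b) + p a * C, p a * P, ?_, by positivity, ?_⟩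
    · exact add_nonneg (add_nonneg (hκ x)
        (Finset.sum_nonneg fun b _ => mul_nonneg (hp b) (hw _))) (by positivity)
    intro f m hf hm
    have h1 := (hf x).trans (bellman_le_of_selection (s := fun b => if b = a then y else s x b) hp
      zero_le_one (fun b => by
        split_ifs with h
        · exact h ▸ hy
        · exact hs x b))
    have h2 : ∑ b, p b * f (if b = a then y else s x b) ≤
        ∑ b, (p b * w (s x b) + p b * m + if b = a then p b * (f y - m) else 0) := by
      refine Finset.sum_le_sum fun b _ => ?_
      split_ifs with h
      · have := mul_nonneg (hp b) (hw (s x b))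
        nlinarith
      · have := mul_le_mul_of_nonneg_left (hm (s x b)) (hp b)
        linarith
    rw [Finset.sum_add_distrib, Finset.sum_add_distrib, ← Finset.sum_mul, hp1,
      Finset.sum_ite_eq' Finset.univ a] at h2
    simp only [Finset.mem_univ, if_true] at h2
    have h3 := mul_le_mul_of_nonneg_left (ih f m hf hm) ha.le
    linarith

/-- Under a Lyapunov condition and reachability, the discounted value functions exist and have
oscillation bounded uniformly in the discount factor. -/
theorem exists_value_bounded_oscillation [Nonempty Q] (hp : ∀ a, 0 ≤ p a) (hp1 : ∑ a, p a = 1)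
    (hκ : ∀ q, 0 ≤ κ q) (hfin : ∀ C, {q | κ q ≤ C}.Finite) (hw : ∀ q, 0 ≤ w q) (hK : 0 ≤ K)
    (hs : ∀ q a, s q a ∈ N q a)
    (hdrift : ∀ q, ∑ a, p a * w (s q a) ≤ w q - 2 * κ q + K)
    (hreach : ∀ q q', Relation.ReflTransGen (fun x y => ∃ a, 0 < p a ∧ y ∈ N x a) q q') :
    ∃ (B : ℝ) (b : Q → ℝ), ∀ r : ℝ, 0 ≤ r → r < 1 → ∃ (W : Q → ℝ) (m : ℝ),
      (∀ q, Tendsto (fun n => valueIter p N hN κ r n q) atTop (nhds (W q))) ∧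
      bellman p N hN κ r W = W ∧ (∀ q, m ≤ W q) ∧ (∀ q, W q ≤ m + b q) ∧
      0 ≤ (1 - r) * m ∧ (1 - r) * m ≤ B := by
  obtain ⟨q₀⟩ := ‹Nonempty Q›
  choose C P hC hP hCP using fun q q' =>
    exists_le_of_reachable (hN := hN) hp hp1 hκ hw hs (hreach q q')
  -- The threshold is large enough for `F` to contain both the set `κ ≤ K` and, for every `r`, the
  -- minimizer of the discounted value.
  have hFfin := hfin (w q₀ + K)
  set F : Finset Q := hFfin.toFinset with hF
  have hmemF : ∀ q, q ∈ F ↔ κ q ≤ w q₀ + K := fun q => by simp [hF]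
  -- The extremal points `q₁`, `q₂` below depend on `r`; summing over all pairs of `F` gives a bound
  -- that does not.
  refine ⟨w q₀ + K, fun q => w q + ∑ x ∈ F, ∑ y ∈ F, C x y / P x y, fun r hr hr1 => ?_⟩
  have h1r : 0 < 1 - r := by linarith
  have hbound := fun n => valueIter_le_lyapunov (hN := hN) hp hp1 hκ hr hr1 hw hs hdrift n hK
  obtain ⟨W, hlim, hle, hfix⟩ := exists_tendsto_valueIter hp hκ hr hbound
  have hW0 : 0 ≤ W := hle 0
  have hWκ : ∀ q, κ q ≤ W q := fun q => by
    rw [← hfix]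
    exact le_add_of_nonneg_right (mul_nonneg hr (Finset.sum_nonneg fun a _ =>
      mul_nonneg (hp a) (Finset.le_inf' _ _ fun b _ => hW0 b)))
  have hWup : ∀ q, W q ≤ w q + K / (1 - r) := fun q =>
    le_of_tendsto' (hlim q) fun n => hbound n q
  obtain ⟨q₁, -, hq₁⟩ : ∃ q₁ ∈ {q | W q ≤ W q₀}, ∀ q ∈ {q | W q ≤ W q₀}, W q₁ ≤ W q :=
    Set.exists_min_image _ W ((hfin (W q₀)).subset fun q hq => (hWκ q).trans hq) ⟨q₀, le_refl (W q₀)⟩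
  have hmin : ∀ q, W q₁ ≤ W q := fun q => by
    rcases le_total (W q) (W q₀) with h | h
    · exact hq₁ q h
    · exact (hq₁ q₀ (le_refl (W q₀))).trans h
  have hB : (1 - r) * W q₁ ≤ w q₀ + K := by
    have h1 := mul_le_mul_of_nonneg_left ((hmin q₀).trans (hWup q₀)) h1r.le
    have h2 : (1 - r) * (w q₀ + K / (1 - r)) = (1 - r) * w q₀ + K := by field_simp
    nlinarith [hw q₀]
  -- At a minimizer every continuation has value at least `W q₁`, so the fixed point equation bounds
  -- the running cost there.
  have hκq₁ : κ q₁ ≤ (1 - r) * W q₁ := by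
    have h1 : κ q₁ + r * W q₁ ≤ W q₁ := by
      conv_rhs => rw [← hfix]
      unfold bellman
      gcongr
      calc W q₁ = ∑ a, p a * W q₁ := by rw [← Finset.sum_mul, hp1, one_mul]
        _ ≤ _ := Finset.sum_le_sum fun a _ => mul_le_mul_of_nonneg_left
          (Finset.le_inf' _ _ fun b _ => hmin b) (hp a)
    linarith
  have hq₁F : q₁ ∈ F := (hmemF _).2 (hκq₁.trans hB)
  obtain ⟨q₂, hq₂F, hq₂⟩ := Finset.exists_max_image F W ⟨q₁, hq₁F⟩
  have hsub : ∀ q, W q ≤ w q + W q₂ := fun q =>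
    le_of_tendsto' (hlim q) fun n => valueIter_le_of_le_on_sublevel hp hp1 hr hr1 hw hs hdrift
      (hW0 q₂) (fun n q hq => (hle n q).trans
        (hq₂ q ((hmemF q).2 (hq.trans (le_add_of_nonneg_left (hw q₀)))))) n q
  have hbell : ∀ q, W q ≤ bellman p N hN κ 1 W q := fun q => by
    conv_lhs => rw [← hfix]
    unfold bellman
    gcongr
    exact Finset.sum_nonneg fun a _ => mul_nonneg (hp a) (Finset.le_inf' _ _ fun b _ => hW0 b)
  have hosc : W q₂ ≤ W q₁ + ∑ x ∈ F, ∑ y ∈ F, C x y / P x y := by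
    -- With `m = W q₂` the path bound becomes `P * (W q₂ - W q₁) ≤ C`.
    have h1 := hCP q₂ q₁ W (W q₂) hbell hsub
    have h2 : W q₂ - W q₁ ≤ C q₂ q₁ / P q₂ q₁ := by
      rw [le_div_iff₀ (hP _ _)]
      linarith
    have hnn : ∀ x y, 0 ≤ C x y / P x y := fun x y => div_nonneg (hC x y) (hP x y).le
    have h3 : C q₂ q₁ / P q₂ q₁ ≤ ∑ y ∈ F, C q₂ y / P q₂ y :=
      Finset.single_le_sum (f := fun y => C q₂ y / P q₂ y) (fun y _ => hnn _ y) hq₁F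
    have h4 : ∑ y ∈ F, C q₂ y / P q₂ y ≤ ∑ x ∈ F, ∑ y ∈ F, C x y / P x y :=
      Finset.single_le_sum (f := fun x => ∑ y ∈ F, C x y / P x y)
        (fun x _ => Finset.sum_nonneg fun y _ => hnn x y) hq₂F
    linarith
  exact ⟨W, W q₁, hlim, hfix, hmin, fun q => by linarith [hsub q],
    mul_nonneg h1r.le (hW0 q₁), hB⟩

/-- Vanishing discount: the average cost optimality equation has a nonnegative solution, and its
constant is a lower bound for the growth of the discounted values. -/
theorem exists_average_cost_optimality [Nonempty Q] (hp : ∀ a, 0 ≤ p a) (hp1 : ∑ a, p a = 1)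
    (hκ : ∀ q, 0 ≤ κ q) (hfin : ∀ C, {q | κ q ≤ C}.Finite) (hw : ∀ q, 0 ≤ w q) (hK : 0 ≤ K)
    (hs : ∀ q a, s q a ∈ N q a)
    (hdrift : ∀ q, ∑ a, p a * w (s q a) ≤ w q - 2 * κ q + K)
    (hreach : ∀ q q', Relation.ReflTransGen (fun x y => ∃ a, 0 < p a ∧ y ∈ N x a) q q') :
    ∃ (η : ℝ) (h : Q → ℝ), 0 ≤ η ∧ 0 ≤ h ∧ (∀ q, bellman p N hN κ 1 h q = η + h q) ∧
      ∀ (t : Finset Q) (ht : t.Nonempty) (C η' : ℝ),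
        (∀ r : ℝ, 0 ≤ r → r < 1 → ∀ n,
          r * t.inf' ht (valueIter p N hN κ r n) ≤ C + η' / (1 - r)) → η ≤ η' := by
  obtain ⟨B, b, hBb⟩ :=
    exists_value_bounded_oscillation (hN := hN) hp hp1 hκ hfin hw hK hs hdrift hreach
  let r : ℕ → ℝ := fun n => 1 - 1 / ((n : ℝ) + 1)
  have hr0 : ∀ n, 0 ≤ r n := fun n => by
    have : 1 / ((n : ℝ) + 1) ≤ 1 := (div_le_one (by positivity)).2
      (by linarith [n.cast_nonneg (α := ℝ)])
    simp only [r]; linarith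
  have hr1 : ∀ n, r n < 1 := fun n => by
    have : 0 < 1 / ((n : ℝ) + 1) := by positivity
    simp only [r]; linarith
  -- Along a nonprincipal ultrafilter all bounded sequences converge at once, which replaces a
  -- diagonal extraction over the states.
  have hrlim : Tendsto r (hyperfilter ℕ : Filter ℕ) (nhds 1) := by
    have := (tendsto_const_nhds (x := (1 : ℝ))).sub
      (tendsto_one_div_add_atTop_nhds_zero_nat (𝕜 := ℝ))
    rw [sub_zero] at this
    exact this.mono_left Nat.hyperfilter_le_atTop
  choose W m hlim hfix hmW hWm hm0 hmB using fun n => hBb (r n) (hr0 n) (hr1 n)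
  have hcomp : ∀ (f : ℕ → ℝ) (c : ℝ), (∀ n, 0 ≤ f n) → (∀ n, f n ≤ c) →
      ∃ l, 0 ≤ l ∧ Tendsto f (hyperfilter ℕ : Filter ℕ) (nhds l) := fun f c h0 h1 => by
    obtain ⟨l, hl, hl'⟩ := (isCompact_Icc (a := (0 : ℝ)) (b := c)).ultrafilter_le_nhds
      ((hyperfilter ℕ).map f) (le_principal_iff.2 (Filter.mem_map.2
        (Filter.univ_mem' fun n => ⟨h0 n, h1 n⟩)))
    exact ⟨l, hl.1, hl'⟩
  obtain ⟨η, hη0, hη⟩ := hcomp (fun n => (1 - r n) * m n) B hm0 hmB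
  choose h hh0 hh using fun q => hcomp (fun n => W n q - m n) (b q)
    (fun n => sub_nonneg.2 (hmW n q)) (fun n => by linarith [hWm n q])
  refine ⟨η, h, hη0, hh0, fun q => ?_, fun t ht C η' hC => ?_⟩
  · have h1 : ∀ n, bellman p N hN κ (r n) (fun q => W n q - m n) q =
        (1 - r n) * m n + (W n q - m n) := fun n => by
      conv_rhs => rw [← hfix n]
      unfold bellman
      simp only [inf'_sub_const, mul_sub, Finset.sum_sub_distrib, ← Finset.sum_mul, hp1]
      ring
    have h2 : Tendsto (fun n => bellman p N hN κ (r n) (fun q => W n q - m n) q)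
        (hyperfilter ℕ : Filter ℕ) (nhds (bellman p N hN κ 1 h q)) :=
      tendsto_const_nhds.add (hrlim.mul (tendsto_finsetSum _ fun a _ =>
        tendsto_const_nhds.mul (Tendsto.finset_inf'_nhds_apply (hN q a) fun b _ => hh b)))
    refine tendsto_nhds_unique h2 ?_
    simp only [h1]
    exact hη.add (hh q)
  · have h1 : ∀ n, r n * ((1 - r n) * m n) ≤ (1 - r n) * C + η' := fun n => by
      have h1r : 0 < 1 - r n := by linarith [hr1 n]
      have h2 : r n * t.inf' ht (W n) ≤ C + η' / (1 - r n) := by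
        refine le_of_tendsto' (tendsto_const_nhds.mul
          (Tendsto.finset_inf'_nhds_apply ht fun b _ => hlim n b)) (hC (r n) (hr0 n) (hr1 n))
      have h3 : m n ≤ t.inf' ht (W n) := Finset.le_inf' _ _ fun b _ => hmW n b
      have h4 := mul_le_mul_of_nonneg_left
        ((mul_le_mul_of_nonneg_left h3 (hr0 n)).trans h2) h1r.le
      have h5 : (1 - r n) * (C + η' / (1 - r n)) = (1 - r n) * C + η' := by field_simp
      linarith
    have h2 : Tendsto (fun n => r n * ((1 - r n) * m n)) (hyperfilter ℕ : Filter ℕ)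
        (nhds (1 * η)) := hrlim.mul hη
    have h3 : Tendsto (fun n => (1 - r n) * C + η') (hyperfilter ℕ : Filter ℕ)
        (nhds ((1 - 1) * C + η')) :=
      ((tendsto_const_nhds.sub hrlim).mul_const C).add_const η'
    simpa using le_of_tendsto_of_tendsto' h2 h3 h1

end Lyapunov

end FiniteControl

/-! ### Verification of average cost optimality for a Markov decision process -/

theorem PMF.tsum_pure_mul {α : Type*} (x : α) (F : α → ℝ≥0∞) :
    ∑' y, PMF.pure x y * F y = F x := by
  rw [tsum_eq_single x fun y hy => by simp [PMF.pure_apply, hy]]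
  simp

theorem PMF.tsum_bind_mul {α β : Type*} (p : PMF α) (f : α → PMF β) (F : β → ℝ≥0∞) :
    ∑' y, p.bind f y * F y = ∑' x, p x * ∑' y, f x y * F y := by
  simp only [PMF.bind_apply, ← ENNReal.tsum_mul_right, ← ENNReal.tsum_mul_left]
  rw [ENNReal.tsum_comm]
  simp only [mul_assoc]

theorem PMF.tsum_map_mul {α β : Type*} (p : PMF α) (g : α → β) (F : β → ℝ≥0∞) :
    ∑' y, p.map g y * F y = ∑' x, p x * F (g x) := by
  rw [← PMF.bind_pure_comp, PMF.tsum_bind_mul]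
  simp only [Function.comp, PMF.tsum_pure_mul]

theorem PMF.tsum_mul_const {α : Type*} (p : PMF α) (c : ℝ≥0∞) : ∑' x, p x * c = c := by
  rw [ENNReal.tsum_mul_right, p.tsum_coe, one_mul]

/-- Abel summation: a linear bound on partial sums bounds the discounted sums. -/
theorem sum_pow_mul_le_of_sum_le {c : ℕ → ℝ} {C η r : ℝ} (hr : 0 ≤ r) (hr1 : r ≤ 1)
    (h : ∀ n, ∑ t ∈ Finset.range n, c t ≤ C + n * η) (n : ℕ) :
    ∑ t ∈ Finset.range n, r ^ t * c t ≤ C + η * ∑ t ∈ Finset.range n, r ^ t := by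
  have hC : 0 ≤ C := by simpa using h 0
  -- The discounted sum is bounded by a convex combination of the current partial sum and its upper
  -- bound `C`; raising `n` only moves weight to `C`.
  have key : ∀ n, ∑ t ∈ Finset.range n, r ^ t * (c t - η) ≤
      r ^ n * (∑ t ∈ Finset.range n, (c t - η)) + (1 - r ^ n) * C := fun n => by
    induction n with
    | zero => simp
    | succ n ih =>
      have hS : ∑ t ∈ Finset.range (n + 1), (c t - η) ≤ C := by
        have := h (n + 1)
        rw [Finset.sum_sub_distrib]
        simp only [Finset.sum_const, Finset.card_range, nsmul_eq_mul]
        linarith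
      rw [Finset.sum_range_succ] at hS ⊢
      rw [Finset.sum_range_succ, pow_succ]
      have h1 : 0 ≤ r ^ n * (1 - r) := mul_nonneg (pow_nonneg hr n) (by linarith)
      have h2 := mul_le_mul_of_nonneg_left hS h1
      nlinarith
  have h1 := key n
  have h2 : ∑ t ∈ Finset.range n, (c t - η) ≤ C := by
    have := h n
    rw [Finset.sum_sub_distrib]
    simp only [Finset.sum_const, Finset.card_range, nsmul_eq_mul]
    linarith
  have h3 := mul_le_mul_of_nonneg_left h2 (pow_nonneg hr n)
  have h4 : ∑ t ∈ Finset.range n, r ^ t * (c t - η) =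
      ∑ t ∈ Finset.range n, r ^ t * c t - η * ∑ t ∈ Finset.range n, r ^ t := by
    rw [Finset.mul_sum, ← Finset.sum_sub_distrib]
    exact Finset.sum_congr rfl fun t _ => by ring
  linarith

namespace MDP

variable {M : MDP.{w}}

/-- The expected value of a function of the state at time `t`. -/
noncomputable def expect (M : MDP.{w}) (π : M.Policy) (x : M.State) (t : ℕ)
    (F : M.State → ℝ≥0∞) : ℝ≥0∞ :=
  ∑' h : List M.State × M.State, M.histLaw π x t h * F h.2

theorem expect_zero (π : M.Policy) (x : M.State) (F : M.State → ℝ≥0∞) :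
    M.expect π x 0 F = F x := by
  unfold expect histLaw
  exact PMF.tsum_pure_mul _ _

theorem expect_succ (π : M.Policy) (x : M.State) (t : ℕ) (F : M.State → ℝ≥0∞) :
    M.expect π x (t + 1) F = ∑' h : List M.State × M.State, M.histLaw π x t h *
      ∑' a, π h.1 h.2 a * ∑' y, M.trans h.2 a y * F y := by
  unfold expect
  rw [histLaw, PMF.tsum_bind_mul]
  simp only [PMF.tsum_bind_mul, PMF.tsum_map_mul]

/-- Subsolutions of the discounted optimality equations bound the discounted cost of every
policy from below. -/
theorem le_sum_pow_mul_expCost {r : ℝ≥0∞} {f : ℕ → M.State → ℝ≥0∞} (h0 : ∀ s, f 0 s = 0)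
    (hf : ∀ n s (a : M.Act s), f (n + 1) s ≤ M.cost s + r * ∑' y, M.trans s a y * f n y)
    (π : M.Policy) (x : M.State) (n t : ℕ) :
    M.expect π x t (f n) ≤ ∑ k ∈ Finset.range n, r ^ k * M.expCost π x (t + k) := by
  induction n generalizing t with
  | zero => simp [expect, h0]
  | succ n ih =>
    have h1 : M.expect π x t (f (n + 1)) ≤
        M.expCost π x t + r * M.expect π x (t + 1) (f n) := by
      rw [expect_succ, expCost, ← ENNReal.tsum_mul_left, ← ENNReal.tsum_add]
      refine ENNReal.tsum_le_tsum fun h => ?_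
      rw [mul_left_comm, ← mul_add]
      gcongr
      rw [← PMF.tsum_mul_const (π h.1 h.2) (f (n + 1) h.2),
        ← PMF.tsum_mul_const (π h.1 h.2) (M.cost h.2), ← ENNReal.tsum_mul_left,
        ← ENNReal.tsum_add]
      refine ENNReal.tsum_le_tsum fun a => ?_
      rw [mul_left_comm, ← mul_add]
      gcongr
      exact hf n h.2 a
    rw [Finset.sum_range_succ']
    refine h1.trans ?_
    rw [add_comm, pow_zero, one_mul, add_zero]
    gcongr
    refine (mul_le_mul_right (ih (t + 1)) r).trans (le_of_eq ?_)
    rw [Finset.mul_sum]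
    refine Finset.sum_congr rfl fun k _ => ?_
    rw [pow_succ', mul_assoc, add_assoc, add_comm 1 k]

/-- Solutions of the average cost optimality inequality bound the cost of the stationary policy. -/
theorem avgCost_stationary_le {φ : (s : M.State) → M.Act s} {H : M.State → ℝ≥0∞} {η : ℝ≥0}
    (hfin : ∀ s, H s ≠ ∞)
    (hH : ∀ s, M.cost s + ∑' y, M.trans s (φ s) y * H y ≤ η + H s) (x : M.State) :
    M.avgCost (M.stationary φ) x ≤ η := by
  set π := M.stationary φ
  have hstep : ∀ t, M.expCost π x t + M.expect π x (t + 1) H ≤ η + M.expect π x t H := fun t => by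
    rw [expect_succ, expCost, expect, ← PMF.tsum_mul_const (M.histLaw π x t) (η : ℝ≥0∞),
      ← ENNReal.tsum_add, ← ENNReal.tsum_add]
    refine ENNReal.tsum_le_tsum fun h => ?_
    rw [← mul_add, ← mul_add]
    refine mul_le_mul_right ?_ _
    have hπ : π h.1 h.2 = PMF.pure (φ h.2) := rfl
    rw [hπ, PMF.tsum_pure_mul]
    exact hH h.2
  have hsum : ∀ n : ℕ, ∑ t ∈ Finset.range n, M.expCost π x t + M.expect π x n H ≤
      n * η + H x := fun n => by
    induction n with
    | zero => simp [expect_zero]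
    | succ n ih =>
      rw [Finset.sum_range_succ, add_assoc]
      refine (add_le_add_right (hstep n) _).trans ?_
      rw [add_left_comm]
      refine (add_le_add_right ih _).trans (le_of_eq ?_)
      push_cast
      ring
  have hlim : Tendsto (fun n : ℕ => (η : ℝ≥0∞) + H x / n) atTop (nhds η) := by
    have h1 := ENNReal.Tendsto.const_mul (a := H x) ENNReal.tendsto_inv_nat_nhds_zero
      (Or.inr (hfin x))
    simpa [div_eq_mul_inv] using (tendsto_const_nhds (x := (η : ℝ≥0∞))).add h1
  rw [avgCost, ← hlim.limsup_eq]
  refine limsup_le_limsup ?_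
  filter_upwards [eventually_gt_atTop 0] with n hn
  have h1 : (n : ℝ≥0∞) ≠ 0 := by exact_mod_cast hn.ne'
  rw [ENNReal.div_le_iff h1 (ENNReal.natCast_ne_top n), add_mul,
    ENNReal.div_mul_cancel h1 (ENNReal.natCast_ne_top n), mul_comm]
  -- The discarded expectation of `H` at time `n` is nonnegative, so no growth condition on `H` is
  -- needed.
  exact le_self_add.trans (hsum n)

/-- If the average cost is below `η`, then the partial sums of the expected costs grow at
most like `η`. -/
theorem exists_sum_expCost_le {π : M.Policy} {x : M.State} {η : ℝ≥0} (h : M.avgCost π x < η) :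
    (∀ t, M.expCost π x t ≠ ∞) ∧ ∃ C : ℝ, ∀ n : ℕ,
      ∑ t ∈ Finset.range n, (M.expCost π x t).toReal ≤ C + n * (η : ℝ) := by
  obtain ⟨n₀, hn₀⟩ := eventually_atTop.1 (eventually_lt_of_limsup_lt h)
  have hle : ∀ n, n₀ ≤ n → 0 < n → ∑ t ∈ Finset.range n, M.expCost π x t ≤ n * η :=
    fun n h1 h2 => by
      have h3 : (n : ℝ≥0∞) ≠ 0 := by exact_mod_cast h2.ne'
      have := (hn₀ n h1).le
      rwa [ENNReal.div_le_iff h3 (ENNReal.natCast_ne_top n), mul_comm] at this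
  have hfin : ∀ t, M.expCost π x t ≠ ∞ := fun t => by
    refine ne_top_of_le_ne_top ?_ ((Finset.single_le_sum (f := M.expCost π x)
      (fun i _ => zero_le) (Finset.mem_range.2 (by omega : t < n₀ + t + 1))).trans
      (hle (n₀ + t + 1) (by omega) (by omega)))
    exact ENNReal.mul_ne_top (ENNReal.natCast_ne_top _) ENNReal.coe_ne_top
  -- The bound by `η` holds only from `n₀` on; `C` covers the earlier partial sums.
  refine ⟨hfin, ∑ t ∈ Finset.range n₀, (M.expCost π x t).toReal, fun n => ?_⟩
  have hnn : ∀ t, 0 ≤ (M.expCost π x t).toReal := fun t => ENNReal.toReal_nonneg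
  rcases le_or_gt n n₀ with hn | hn
  · refine (Finset.sum_le_sum_of_subset_of_nonneg (Finset.range_mono hn)
      fun t _ _ => hnn t).trans (le_add_of_nonneg_right (by positivity))
  · refine le_trans ?_ (le_add_of_nonneg_left (Finset.sum_nonneg fun t _ => hnn t))
    rw [← ENNReal.toReal_sum fun t _ => hfin t]
    have := ENNReal.toReal_mono (ENNReal.mul_ne_top (ENNReal.natCast_ne_top _)
      ENNReal.coe_ne_top) (hle n hn.le (by omega))
    simpa using this

/-- The vanishing discount verification theorem. -/
theorem hasOptimalAverageCost_of_discounted {η : ℝ≥0} {φ : (s : M.State) → M.Act s}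
    {H : M.State → ℝ≥0∞} (hfin : ∀ s, H s ≠ ∞)
    (hH : ∀ s, M.cost s + ∑' y, M.trans s (φ s) y * H y ≤ η + H s)
    {f : ℝ → ℕ → M.State → ℝ} (h0 : ∀ r s, f r 0 s = 0)
    (hf : ∀ r : ℝ, 0 ≤ r → r < 1 → ∀ n s (a : M.Act s), ENNReal.ofReal (f r (n + 1) s) ≤
      M.cost s + ENNReal.ofReal r * ∑' y, M.trans s a y * ENNReal.ofReal (f r n y))
    (hlow : ∀ (s : M.State) (C : ℝ) (η' : ℝ≥0),
      (∀ r : ℝ, 0 ≤ r → r < 1 → ∀ n, f r n s ≤ C + η' / (1 - r)) → η ≤ η') :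
    M.HasOptimalAverageCost η := by
  have hlower : ∀ (π : M.Policy) x, (η : ℝ≥0∞) ≤ M.avgCost π x := fun π x => by
    -- It suffices to show `η ≤ b` for each `b` strictly above the average cost, since then the
    -- partial sums are eventually at most `n * b`.
    refine le_of_forall_gt_imp_ge_of_dense fun b hb => ?_
    rcases eq_or_ne b ∞ with rfl | hbt
    · exact le_top
    lift b to ℝ≥0 using hbt
    obtain ⟨hne, C, hC⟩ := exists_sum_expCost_le hb
    refine ENNReal.coe_le_coe.2 (hlow x C b fun r hr hr1 n => ?_)
    have h1 := le_sum_pow_mul_expCost (f := fun n s => ENNReal.ofReal (f r n s))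
      (fun s => by simp [h0]) (hf r hr hr1) π x n 0
    rw [expect_zero] at h1
    have h2 : ∑ k ∈ Finset.range n, ENNReal.ofReal r ^ k * M.expCost π x (0 + k) =
        ENNReal.ofReal (∑ k ∈ Finset.range n, r ^ k * (M.expCost π x k).toReal) := by
      rw [ENNReal.ofReal_sum_of_nonneg fun k _ =>
        mul_nonneg (pow_nonneg hr k) ENNReal.toReal_nonneg]
      refine Finset.sum_congr rfl fun k _ => ?_
      rw [ENNReal.ofReal_mul (pow_nonneg hr k), ENNReal.ofReal_pow hr,
        ENNReal.ofReal_toReal (hne k), zero_add]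
    rw [h2, ENNReal.ofReal_le_ofReal_iff (Finset.sum_nonneg fun k _ =>
      mul_nonneg (pow_nonneg hr k) ENNReal.toReal_nonneg)] at h1
    refine h1.trans ((sum_pow_mul_le_of_sum_le hr hr1.le hC n).trans ?_)
    rw [div_eq_mul_inv]
    gcongr
    rw [← tsum_geometric_of_lt_one hr hr1]
    exact (summable_geometric_of_lt_one hr hr1).sum_le_tsum _ fun k _ => pow_nonneg hr k
  refine ⟨fun x => le_antisymm ((iInf_le _ _).trans (avgCost_stationary_le hfin hH x))
    (le_iInf fun π => hlower π x), φ, fun x => le_antisymm (avgCost_stationary_le hfin hH x)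
    (hlower _ x)⟩

end MDP

/-! ### Stabilizability of the matching model -/

theorem Finset.exists_pos_forall_le {ι : Type*} (s : Finset ι) (f : ι → ℝ)
    (h : ∀ i ∈ s, 0 < f i) : ∃ ε > 0, ∀ i ∈ s, ε ≤ f i := by
  rcases s.eq_empty_or_nonempty with rfl | hs
  · exact ⟨1, one_pos, by simp⟩
  · obtain ⟨i, hi, hmin⟩ := s.exists_min_image f hs
    exact ⟨f i, h i hi, hmin⟩

/-- Layer-cake formula: it reduces weighted sums of `q` to weights of its level sets, to which
`NCond` applies. -/
theorem sum_mul_natCast_eq_sum_layers {ι : Type*} [Fintype ι] (α : ι → ℝ) (q : ι → ℕ) {T : ℕ}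
    (hT : ∀ i, q i ≤ T) :
    ∑ i, α i * (q i : ℝ) = ∑ t ∈ Finset.range T, ∑ i with t < q i, α i := by
  simp only [Finset.sum_filter]
  rw [Finset.sum_comm]
  refine Finset.sum_congr rfl fun i _ => ?_
  rw [← Finset.sum_filter, Finset.sum_const, nsmul_eq_mul, mul_comm]
  congr 2
  rw [show (Finset.range T).filter (fun t => t < q i) = Finset.range (q i) by
    ext t; have := hT i; simp only [Finset.mem_filter, Finset.mem_range]; omega]
  simp

/-- A Hall-type condition on all level sets of `q` bounds the weighted sum of `q` by the weighted
sum of the maxima of `q` over neighborhoods. -/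
theorem sum_mul_add_le_sum_mul_sup {ι κ : Type*} [Fintype ι] [Fintype κ] (α : ι → ℝ) (β : κ → ℝ)
    (nb : κ → Finset ι) (q : ι → ℕ) (ε : ℝ) (n : ℕ)
    (h : ∀ t, ∑ i with t < q i, α i + (if t < n then ε else 0) ≤
      ∑ j with ∃ i ∈ nb j, t < q i, β j) :
    ∑ i, α i * (q i : ℝ) + ε * n ≤ ∑ j, β j * (((nb j).sup q : ℕ) : ℝ) := by
  have hq : ∀ i, q i ≤ Finset.univ.sup q + n := fun i =>
    (Finset.le_sup (Finset.mem_univ i)).trans (Nat.le_add_right _ _)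
  have hsup : ∀ j, (nb j).sup q ≤ Finset.univ.sup q + n := fun j =>
    (Finset.sup_mono (Finset.subset_univ _)).trans (Nat.le_add_right _ _)
  rw [sum_mul_natCast_eq_sum_layers α q hq,
    sum_mul_natCast_eq_sum_layers β (fun j => (nb j).sup q) hsup]
  have h1 : ε * n = ∑ t ∈ Finset.range (Finset.univ.sup q + n), if t < n then ε else 0 := by
    rw [← Finset.sum_filter, Finset.sum_const, nsmul_eq_mul, mul_comm,
      show (Finset.range (Finset.univ.sup q + n)).filter (fun t => t < n) = Finset.range n by
        ext t; simp only [Finset.mem_filter, Finset.mem_range]; omega]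
    simp
  rw [h1, ← Finset.sum_add_distrib]
  refine Finset.sum_le_sum fun t _ => (h t).trans (le_of_eq ?_)
  -- A maximum over a neighborhood exceeds `t` exactly when the neighborhood meets the level set
  -- above `t`.
  simp only [Finset.lt_sup_iff]

namespace MatchingModel

variable {D : Type u} {S : Type v}

theorem exists_edge_of_connected (M : MatchingModel D S) (hconn : M.graph.Connected)
    [Nonempty D] [Nonempty S] :
    (∀ i, ∃ j, (i, j) ∈ M.edges) ∧ ∀ j, ∃ i, (i, j) ∈ M.edges := by
  have key : ∀ k l : D ⊕ S, k ≠ l → ∃ m, M.graph.Adj k m := fun k l hkl => by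
    obtain ⟨W⟩ := hconn.preconnected k l
    cases W with
    | nil => exact absurd rfl hkl
    | cons h _ => exact ⟨_, h⟩
  constructor
  · intro i
    obtain ⟨j₀⟩ := ‹Nonempty S›
    obtain ⟨m, e, he, ⟨h1, h2⟩ | ⟨h1, h2⟩⟩ := key (Sum.inl i) (Sum.inr j₀) (by simp)
    · rw [Sum.inl.injEq] at h1
      exact ⟨e.2, h1 ▸ he⟩
    · simp at h1
  · intro j
    obtain ⟨i₀⟩ := ‹Nonempty D›
    obtain ⟨m, e, he, ⟨h1, h2⟩ | ⟨h1, h2⟩⟩ := key (Sum.inr j) (Sum.inl i₀) (by simp)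
    · simp at h1
    · rw [Sum.inr.injEq] at h1
      exact ⟨e.1, h1 ▸ he⟩

variable [Fintype D] [Fintype S] [DecidableEq D] [DecidableEq S]

theorem nonempty_classes (M : MatchingModel D S) : Nonempty D ∧ Nonempty S := by
  obtain ⟨e, -⟩ := M.law.support_nonempty
  exact ⟨⟨e.1.1⟩, ⟨e.1.2⟩⟩

theorem sum_law_toReal (M : MatchingModel D S) : ∑ e, (M.law e).toReal = 1 := by
  have h := M.law.tsum_coe
  rw [tsum_fintype] at h
  rw [← ENNReal.toReal_sum fun e _ => M.law.apply_ne_top e, h, ENNReal.toReal_one]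

theorem sum_rate_inl_mul (M : MatchingModel D S) (g : D → ℝ) :
    ∑ i, M.rate (Sum.inl i) * g i = ∑ e, (M.law e).toReal * g e.1.1 := by
  simp only [rate, Finset.sum_mul]
  rw [Finset.sum_comm]
  refine Finset.sum_congr rfl fun e _ => ?_
  simp [pairVec, Pi.single_apply]

theorem sum_rate_inr_mul (M : MatchingModel D S) (g : S → ℝ) :
    ∑ j, M.rate (Sum.inr j) * g j = ∑ e, (M.law e).toReal * g e.1.2 := by
  simp only [rate, Finset.sum_mul]
  rw [Finset.sum_comm]
  refine Finset.sum_congr rfl fun e _ => ?_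
  simp [pairVec, Pi.single_apply]

theorem sum_rate_inl (M : MatchingModel D S) : ∑ i, M.rate (Sum.inl i) = 1 := by
  simpa only [mul_one, sum_law_toReal] using M.sum_rate_inl_mul fun _ => 1

theorem sum_rate_inr (M : MatchingModel D S) : ∑ j, M.rate (Sum.inr j) = 1 := by
  simpa only [mul_one, sum_law_toReal] using M.sum_rate_inr_mul fun _ => 1

theorem rate_nonneg (M : MatchingModel D S) (k : D ⊕ S) : 0 ≤ M.rate k :=
  Finset.sum_nonneg fun _ _ => mul_nonneg ENNReal.toReal_nonneg (Nat.cast_nonneg _)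

/-- `NCond` for the complement of a single class forces the other classes on its side to have total
rate below one. If there are no others, the rate is one. -/
theorem rate_pos (M : MatchingModel D S) (hN : M.NCond) (k : D ⊕ S) : 0 < M.rate k := by
  rcases k with i | j
  · by_cases h : (Finset.univ.erase i : Finset D).Nonempty
    · have h1 := hN.1 _ h (by simp [Finset.erase_eq_self])
      have h2 : ∑ j ∈ M.supplyOf (Finset.univ.erase i), M.rate (Sum.inr j) ≤ 1 := by
        rw [← M.sum_rate_inr]
        exact Finset.sum_le_sum_of_subset_of_nonneg (Finset.subset_univ _)
          fun j _ _ => M.rate_nonneg _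
      have h3 := Finset.add_sum_erase Finset.univ (fun i => M.rate (Sum.inl i)) (Finset.mem_univ i)
      have h4 := M.sum_rate_inl
      linarith
    · rw [Finset.not_nonempty_iff_eq_empty] at h
      have h3 := Finset.add_sum_erase Finset.univ (fun i => M.rate (Sum.inl i)) (Finset.mem_univ i)
      rw [h, M.sum_rate_inl, Finset.sum_empty] at h3
      linarith
  · by_cases h : (Finset.univ.erase j : Finset S).Nonempty
    · have h1 := hN.2 _ h (by simp [Finset.erase_eq_self])
      have h2 : ∑ i ∈ M.demandOf (Finset.univ.erase j), M.rate (Sum.inl i) ≤ 1 := by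
        rw [← M.sum_rate_inl]
        exact Finset.sum_le_sum_of_subset_of_nonneg (Finset.subset_univ _)
          fun j _ _ => M.rate_nonneg _
      have h3 := Finset.add_sum_erase Finset.univ (fun i => M.rate (Sum.inr i)) (Finset.mem_univ j)
      have h4 := M.sum_rate_inr
      linarith
    · rw [Finset.not_nonempty_iff_eq_empty] at h
      have h3 := Finset.add_sum_erase Finset.univ (fun i => M.rate (Sum.inr i)) (Finset.mem_univ j)
      rw [h, M.sum_rate_inr, Finset.sum_empty] at h3
      linarith

/-- The supply classes adjacent to a demand class. -/
def supplyNbrs (M : MatchingModel D S) (i : D) : Finset S :=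
  Finset.univ.filter fun j => (i, j) ∈ M.edges

/-- The demand classes adjacent to a supply class. -/
def demandNbrs (M : MatchingModel D S) (j : S) : Finset D :=
  Finset.univ.filter fun i => (i, j) ∈ M.edges

theorem exists_slack (M : MatchingModel D S) (hN : M.NCond) :
    ∃ ε > 0, ∀ B : Finset D, B.Nonempty → B ≠ Finset.univ →
      ∑ i ∈ B, M.rate (Sum.inl i) + ε ≤ ∑ j ∈ M.supplyOf B, M.rate (Sum.inr j) := by
  obtain ⟨ε, hε, h⟩ := Finset.exists_pos_forall_le
    (Finset.univ.filter fun B : Finset D => B.Nonempty ∧ B ≠ Finset.univ)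
    (fun B => ∑ j ∈ M.supplyOf B, M.rate (Sum.inr j) - ∑ i ∈ B, M.rate (Sum.inl i))
    (fun B hB => by
      rw [Finset.mem_filter] at hB
      exact sub_pos.2 (hN.1 B hB.2.1 hB.2.2))
  refine ⟨ε, hε, fun B h1 h2 => ?_⟩
  have := h B (by simp [h1, h2])
  linarith

/-- The rate at which the longest-neighbor matching of an arriving demand changes the quadratic
Lyapunov function. -/
noncomputable def demandDrift (M : MatchingModel D S) (q : D ⊕ S → ℕ) (i : D) : ℝ :=
  (if (M.supplyNbrs i).sup (fun j => q (Sum.inr j)) = 0 then (q (Sum.inl i) : ℝ) else 0) -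
    ((M.supplyNbrs i).sup (fun j => q (Sum.inr j)) : ℕ)

/-- The rate at which the longest-neighbor matching of an arriving supply changes the quadratic
Lyapunov function. -/
noncomputable def supplyDrift (M : MatchingModel D S) (q : D ⊕ S → ℕ) (j : S) : ℝ :=
  (if (M.demandNbrs j).sup (fun i => q (Sum.inl i)) = 0 then (q (Sum.inr j) : ℝ) else 0) -
    ((M.demandNbrs j).sup (fun i => q (Sum.inl i)) : ℕ)

/-- If some demand class is empty, all nonempty demand level sets are proper and `NCond` has slack
`ε` at each of them. If none is empty, every arriving supply finds a match, so the positive part of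
`supplyDrift` vanishes; this gains the mean of `q` over arriving supplies, at least `ρ` times the
total supply, which equals the total demand. -/
theorem exists_negative_drift (M : MatchingModel D S) (hconn : M.graph.Connected)
    (hN : M.NCond) :
    ∃ δ > 0, ∀ q : BalancedState D S,
      ∑ i, M.rate (Sum.inl i) * M.demandDrift q.1 i +
        ∑ j, M.rate (Sum.inr j) * M.supplyDrift q.1 j ≤ -(δ * ∑ i, (q.1 (Sum.inl i) : ℝ)) := by
  obtain ⟨hD, hS⟩ := M.nonempty_classes
  obtain ⟨hedge, hedge'⟩ := M.exists_edge_of_connected hconn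
  obtain ⟨ε, hε, hslack⟩ := M.exists_slack hN
  obtain ⟨ρ, hρ, hrate⟩ := Finset.exists_pos_forall_le Finset.univ M.rate
    fun k _ => M.rate_pos hN k
  have hcard : (0 : ℝ) < Fintype.card D := by exact_mod_cast Fintype.card_pos
  refine ⟨min (ε / Fintype.card D) ρ, lt_min (by positivity) hρ, fun q => ?_⟩
  have hbal : ∑ j, (q.1 (Sum.inr j) : ℝ) = ∑ i, (q.1 (Sum.inl i) : ℝ) := by
    exact_mod_cast q.2.symm
  have hn : 0 ≤ ∑ i, (q.1 (Sum.inl i) : ℝ) := Finset.sum_nonneg fun _ _ => Nat.cast_nonneg _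
  have hsupply : ∀ t : ℕ, (Finset.univ.filter fun j => ∃ i ∈ M.demandNbrs j, t < q.1 (Sum.inl i)) =
      M.supplyOf (Finset.univ.filter fun i => t < q.1 (Sum.inl i)) := fun t => by
    ext j; simp [supplyOf, demandNbrs, and_comm]
  have hdemand : ∀ t : ℕ, (Finset.univ.filter fun i => ∃ j ∈ M.supplyNbrs i, t < q.1 (Sum.inr j)) =
      M.demandOf (Finset.univ.filter fun j => t < q.1 (Sum.inr j)) := fun t => by
    ext j; simp [demandOf, supplyNbrs, and_comm]
  have huniv : ∑ j ∈ M.supplyOf Finset.univ, M.rate (Sum.inr j) = 1 := by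
    rw [← M.sum_rate_inr]
    congr 1
    ext j; simpa [supplyOf] using hedge' j
  have huniv' : ∑ i ∈ M.demandOf Finset.univ, M.rate (Sum.inl i) = 1 := by
    rw [← M.sum_rate_inl]
    congr 1
    ext i; simpa [demandOf] using hedge i
  have hHall : ∀ B, ∑ i ∈ B, M.rate (Sum.inl i) ≤ ∑ j ∈ M.supplyOf B, M.rate (Sum.inr j) :=
    fun B => by
      rcases B.eq_empty_or_nonempty with rfl | h
      · simpa using Finset.sum_nonneg fun j _ => M.rate_nonneg _
      · by_cases h' : B = Finset.univ
        · rw [h', huniv, M.sum_rate_inl]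
        · exact (hN.1 B h h').le
  have hHall' : ∀ B, ∑ j ∈ B, M.rate (Sum.inr j) ≤ ∑ i ∈ M.demandOf B, M.rate (Sum.inl i) :=
    fun B => by
      rcases B.eq_empty_or_nonempty with rfl | h
      · simpa using Finset.sum_nonneg fun j _ => M.rate_nonneg _
      · by_cases h' : B = Finset.univ
        · rw [h', huniv', M.sum_rate_inr]
        · exact (hN.2 B h h').le
  have hA' := sum_mul_add_le_sum_mul_sup (fun j => M.rate (Sum.inr j)) (fun i => M.rate (Sum.inl i))
    M.supplyNbrs (fun j => q.1 (Sum.inr j)) 0 0 fun t => by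
      simpa [hdemand] using hHall' _
  have hdem : ∑ i, M.rate (Sum.inl i) * M.demandDrift q.1 i ≤
      ∑ i, M.rate (Sum.inl i) * (q.1 (Sum.inl i) : ℝ) - ∑ i, M.rate (Sum.inl i) *
        (((M.supplyNbrs i).sup (fun j => q.1 (Sum.inr j)) : ℕ) : ℝ) := by
    rw [← Finset.sum_sub_distrib]
    refine Finset.sum_le_sum fun i _ => ?_
    rw [← mul_sub]
    refine mul_le_mul_of_nonneg_left ?_ (M.rate_nonneg _)
    unfold demandDrift
    gcongr
    split_ifs <;> simp
  by_cases h0 : ∃ i₀, q.1 (Sum.inl i₀) = 0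
  · obtain ⟨i₀, hi₀⟩ := h0
    have hA : ∀ i, ∑ i, M.rate (Sum.inl i) * (q.1 (Sum.inl i) : ℝ) + ε * q.1 (Sum.inl i) ≤
        ∑ j, M.rate (Sum.inr j) *
          (((M.demandNbrs j).sup (fun i => q.1 (Sum.inl i)) : ℕ) : ℝ) := fun i => by
      refine sum_mul_add_le_sum_mul_sup (fun i => M.rate (Sum.inl i))
        (fun j => M.rate (Sum.inr j)) M.demandNbrs (fun i => q.1 (Sum.inl i)) ε _ fun t => ?_
      rw [hsupply]
      split_ifs with ht
      · refine hslack _ ⟨i, by simpa using ht⟩ fun hu => ?_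
        have := Finset.mem_univ i₀
        rw [← hu] at this
        simp [hi₀] at this
      · rw [add_zero]
        exact hHall _
    have hsup : ∑ j, M.rate (Sum.inr j) * M.supplyDrift q.1 j ≤
        ∑ j, M.rate (Sum.inr j) * (q.1 (Sum.inr j) : ℝ) - ∑ j, M.rate (Sum.inr j) *
          (((M.demandNbrs j).sup (fun i => q.1 (Sum.inl i)) : ℕ) : ℝ) := by
      rw [← Finset.sum_sub_distrib]
      refine Finset.sum_le_sum fun i _ => ?_
      rw [← mul_sub]
      refine mul_le_mul_of_nonneg_left ?_ (M.rate_nonneg _)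
      unfold supplyDrift
      gcongr
      split_ifs <;> simp
    -- The gain `ε * q i` is available for each single class `i`; averaging over `i` turns it into a
    -- multiple of the total demand.
    have h1 := Finset.sum_le_sum fun i (_ : i ∈ (Finset.univ : Finset D)) => hA i
    rw [Finset.sum_add_distrib, Finset.sum_const, Finset.sum_const, ← Finset.mul_sum,
      Finset.card_univ, nsmul_eq_mul, nsmul_eq_mul] at h1
    have h2 : ε / Fintype.card D * ∑ i, (q.1 (Sum.inl i) : ℝ) ≤
        ∑ j, M.rate (Sum.inr j) * (((M.demandNbrs j).sup (fun i => q.1 (Sum.inl i)) : ℕ) : ℝ) -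
          ∑ i, M.rate (Sum.inl i) * (q.1 (Sum.inl i) : ℝ) := by
      rw [div_mul_eq_mul_div, div_le_iff₀ hcard]
      linarith
    have h3 := mul_le_mul_of_nonneg_right (min_le_left (ε / Fintype.card D) ρ) hn
    linarith
  · have hA := sum_mul_add_le_sum_mul_sup (fun i => M.rate (Sum.inl i))
      (fun j => M.rate (Sum.inr j)) M.demandNbrs (fun i => q.1 (Sum.inl i)) 0 0 fun t => by
        simpa [hsupply] using hHall _
    have hsup : ∑ j, M.rate (Sum.inr j) * M.supplyDrift q.1 j =
        - ∑ j, M.rate (Sum.inr j) *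
          (((M.demandNbrs j).sup (fun i => q.1 (Sum.inl i)) : ℕ) : ℝ) := by
      rw [← Finset.sum_neg_distrib]
      refine Finset.sum_congr rfl fun j _ => ?_
      obtain ⟨i, hi⟩ := hedge' j
      have h1 : (M.demandNbrs j).sup (fun i => q.1 (Sum.inl i)) ≠ 0 := fun h => by
        rw [← Nat.bot_eq_zero, Finset.sup_eq_bot_iff] at h
        exact h0 ⟨i, h i (by simpa [demandNbrs] using hi)⟩
      simp [supplyDrift, h1]
    have h2 : ρ * ∑ j, (q.1 (Sum.inr j) : ℝ) ≤ ∑ j, M.rate (Sum.inr j) * (q.1 (Sum.inr j) : ℝ) := by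
      rw [Finset.mul_sum]
      exact Finset.sum_le_sum fun j _ =>
        mul_le_mul_of_nonneg_right (hrate _ (Finset.mem_univ _)) (Nat.cast_nonneg _)
    have h3 := mul_le_mul_of_nonneg_right (min_le_right (ε / Fintype.card D) ρ) hn
    rw [hbal] at h2
    simp only [zero_mul, add_zero, CharP.cast_eq_zero] at hA hA'
    linarith

end MatchingModel

/-! ### The longest-neighbor policy and its quadratic Lyapunov function. -/

namespace MatchingModel

variable {D : Type u} {S : Type v} [Fintype D] [Fintype S] [DecidableEq D] [DecidableEq S]

theorem sum_map_pairVec_mem_inputSpace (M : MatchingModel D S) (G : Multiset (D × S))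
    (hG : ∀ e ∈ G, e ∈ M.edges) (hcard : G.card ≤ M.maxMatches) :
    (G.map pairVec).sum ∈ M.inputSpace := by
  refine ⟨fun e => G.count e, by rwa [Multiset.sum_count_eq_card hG], ?_⟩
  rw [Finset.sum_multiset_map_count]
  refine Finset.sum_subset (fun e he => hG e (Multiset.mem_toFinset.1 he)) fun e _ he => ?_
  rw [Multiset.mem_toFinset] at he
  rw [Multiset.count_eq_zero_of_notMem he, zero_smul]

theorem finite_range_remove (M : MatchingModel D S) (x : BalancedState D S) :
    (Set.range (M.remove x)).Finite := by
  have : Finite (M.Input x) := by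
    have h : (Set.Iic x.1).Finite := Set.finite_Iic _
    have : Finite (Set.Iic x.1) := h
    exact Finite.of_injective (fun y : M.Input x => (⟨y.1, y.2.2⟩ : Set.Iic x.1))
      fun y z hyz => Subtype.ext (congrArg (fun t : Set.Iic x.1 => t.1) hyz)
  exact Set.finite_range _

/-- The states that can be reached from `x` by matching. -/
noncomputable def afterMatch (M : MatchingModel D S) (x : BalancedState D S) :
    Finset (BalancedState D S) :=
  (M.finite_range_remove x).toFinset

theorem mem_afterMatch {M : MatchingModel D S} {x q : BalancedState D S} :
    q ∈ M.afterMatch x ↔ ∃ y, M.remove x y = q := by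
  simp [afterMatch]

theorem afterMatch_nonempty (M : MatchingModel D S) (x : BalancedState D S) :
    (M.afterMatch x).Nonempty :=
  ⟨_, mem_afterMatch.2 ⟨⟨0, by simpa using M.sum_map_pairVec_mem_inputSpace 0 (by simp) (by simp),
    fun _ => Nat.zero_le _⟩, rfl⟩⟩

/-- The real linear cost. -/
noncomputable def realCost (M : MatchingModel D S) (x : D ⊕ S → ℕ) : ℝ := ∑ k, M.c k * (x k : ℝ)

/-- The mean cost of the state after an arrival. -/
noncomputable def meanCost (M : MatchingModel D S) (q : BalancedState D S) : ℝ :=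
  ∑ e, (M.law e).toReal * M.realCost (arrive q e.1).1

theorem realCost_nonneg (M : MatchingModel D S) (hcost : ∀ k, 0 < M.c k) (x : D ⊕ S → ℕ) :
    0 ≤ M.realCost x :=
  Finset.sum_nonneg fun k _ => mul_nonneg (hcost k).le (Nat.cast_nonneg _)

theorem meanCost_nonneg (M : MatchingModel D S) (hcost : ∀ k, 0 < M.c k)
    (q : BalancedState D S) : 0 ≤ M.meanCost q :=
  Finset.sum_nonneg fun _ _ => mul_nonneg ENNReal.toReal_nonneg (M.realCost_nonneg hcost _)

theorem meanCost_eq (M : MatchingModel D S) (q : BalancedState D S) :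
    M.meanCost q = M.realCost q.1 + ∑ e, (M.law e).toReal * M.realCost (pairVec e.1) := by
  have h : ∀ e : {e // e ∈ M.arrivals}, M.realCost (arrive q e.1).1 =
      M.realCost q.1 + M.realCost (pairVec e.1) := fun e => by
    simp only [realCost, arrive, Pi.add_apply, Nat.cast_add, mul_add, Finset.sum_add_distrib]
  simp only [meanCost, h, mul_add, Finset.sum_add_distrib]
  rw [← Finset.sum_mul, sum_law_toReal, one_mul]

theorem finite_meanCost_le (M : MatchingModel D S) (hcost : ∀ k, 0 < M.c k) (C : ℝ) :
    {q | M.meanCost q ≤ C}.Finite := by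
  obtain ⟨m, hm, hle⟩ := Finset.exists_pos_forall_le Finset.univ M.c fun k _ => hcost k
  obtain ⟨n, hn⟩ := exists_nat_ge (C / m)
  have hfin : (Set.Iic (fun _ : D ⊕ S => n)).Finite := Set.finite_Iic _
  refine (hfin.preimage (f := fun q : BalancedState D S => q.1)
    Subtype.val_injective.injOn).subset fun q hq k => ?_
  have h1 : m * (q.1 k : ℝ) ≤ C := by
    refine le_trans ?_ ((le_add_of_nonneg_right (Finset.sum_nonneg fun e _ =>
      mul_nonneg ENNReal.toReal_nonneg (M.realCost_nonneg hcost _))).trans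
      ((M.meanCost_eq q).symm.le.trans hq))
    exact (mul_le_mul_of_nonneg_right (hle k (Finset.mem_univ k)) (Nat.cast_nonneg _)).trans
      (Finset.single_le_sum (f := fun k => M.c k * (q.1 k : ℝ))
        (fun k _ => mul_nonneg (hcost k).le (Nat.cast_nonneg _)) (Finset.mem_univ k))
  have h2 : (q.1 k : ℝ) ≤ C / m := by rw [le_div_iff₀ hm]; linarith
  exact_mod_cast h2.trans hn

/-- Matching an arriving demand with its longest neighbor. -/
theorem exists_match_demand (M : MatchingModel D S) (q : D ⊕ S → ℕ) (i : D) :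
    ∃ (G : Multiset (D × S)) (d : D ⊕ S → ℝ), (∀ e ∈ G, e ∈ M.edges) ∧ G.card ≤ 1 ∧
      (∀ k, (G.map pairVec).sum (Sum.inl k) ≤ (Pi.single (Sum.inl i) 1 : D ⊕ S → ℕ) (Sum.inl k)) ∧
      (∀ k, (G.map pairVec).sum (Sum.inr k) ≤ q (Sum.inr k)) ∧
      (∀ k, (((G.map pairVec).sum k : ℕ) : ℝ) =
        ((Pi.single (Sum.inl i) 1 : D ⊕ S → ℕ) k : ℝ) - d k) ∧
      ∑ k, d k ^ 2 = 1 ∧ ∑ k, (q k : ℝ) * d k = M.demandDrift q i := by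
  by_cases h : (M.supplyNbrs i).sup (fun j => q (Sum.inr j)) = 0
  · refine ⟨0, fun k => ((Pi.single (Sum.inl i) 1 : D ⊕ S → ℕ) k : ℝ), by simp, by simp, by simp,
      by simp, by simp, ?_, ?_⟩
    · simp [Pi.single_apply]
    · simp [demandDrift, h, Pi.single_apply]
  · have hne : (M.supplyNbrs i).Nonempty := by
      rw [Finset.nonempty_iff_ne_empty]
      rintro h'
      exact h (by rw [h', Finset.sup_empty, bot_eq_zero])
    obtain ⟨j, hj, hsup⟩ := Finset.exists_mem_eq_sup _ hne (fun j => q (Sum.inr j))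
    have hne0 : q (Sum.inr j) ≠ 0 := by rwa [hsup] at h
    have hpos : 1 ≤ q (Sum.inr j) := Nat.one_le_iff_ne_zero.2 hne0
    refine ⟨{(i, j)}, fun k => -((Pi.single (Sum.inr j) 1 : D ⊕ S → ℕ) k : ℝ), ?_, by simp, ?_,
      ?_, ?_, ?_, ?_⟩
    · simpa [supplyNbrs] using hj
    · intro k
      simp [pairVec]
    · intro k
      by_cases hk : k = j
      · subst hk; simpa [pairVec] using hpos
      · simp [pairVec, hk]
    · intro k
      simp [pairVec]
    · simp [Pi.single_apply]
    · simp [demandDrift, Pi.single_apply, hsup, hne0]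

/-- Matching an arriving supply with its longest neighbor. -/
theorem exists_match_supply (M : MatchingModel D S) (q : D ⊕ S → ℕ) (j : S) :
    ∃ (G : Multiset (D × S)) (d : D ⊕ S → ℝ), (∀ e ∈ G, e ∈ M.edges) ∧ G.card ≤ 1 ∧
      (∀ k, (G.map pairVec).sum (Sum.inr k) ≤ (Pi.single (Sum.inr j) 1 : D ⊕ S → ℕ) (Sum.inr k)) ∧
      (∀ k, (G.map pairVec).sum (Sum.inl k) ≤ q (Sum.inl k)) ∧
      (∀ k, (((G.map pairVec).sum k : ℕ) : ℝ) =
        ((Pi.single (Sum.inr j) 1 : D ⊕ S → ℕ) k : ℝ) - d k) ∧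
      ∑ k, d k ^ 2 = 1 ∧ ∑ k, (q k : ℝ) * d k = M.supplyDrift q j := by
  by_cases h : (M.demandNbrs j).sup (fun i => q (Sum.inl i)) = 0
  · refine ⟨0, fun k => ((Pi.single (Sum.inr j) 1 : D ⊕ S → ℕ) k : ℝ), by simp, by simp, by simp,
      by simp, by simp, ?_, ?_⟩
    · simp [Pi.single_apply]
    · simp [supplyDrift, h, Pi.single_apply]
  · have hne : (M.demandNbrs j).Nonempty := by
      rw [Finset.nonempty_iff_ne_empty]
      rintro h'
      exact h (by rw [h', Finset.sup_empty, bot_eq_zero])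
    obtain ⟨i, hi, hsup⟩ := Finset.exists_mem_eq_sup _ hne (fun i => q (Sum.inl i))
    have hne0 : q (Sum.inl i) ≠ 0 := by rwa [hsup] at h
    have hpos : 1 ≤ q (Sum.inl i) := Nat.one_le_iff_ne_zero.2 hne0
    refine ⟨{(i, j)}, fun k => -((Pi.single (Sum.inl i) 1 : D ⊕ S → ℕ) k : ℝ), ?_, by simp, ?_,
      ?_, ?_, ?_, ?_⟩
    · simpa [demandNbrs] using hi
    · intro k
      simp [pairVec]
    · intro k
      by_cases hk : k = i
      · subst hk; simpa [pairVec] using hpos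
      · simp [pairVec, hk]
    · intro k
      simp [pairVec, add_comm]
    · simp [Pi.single_apply]
    · simp [supplyDrift, Pi.single_apply, hsup, hne0]

/-- One step of the longest-neighbor policy. -/
theorem exists_longest_neighbor_step (M : MatchingModel D S) (hmax : 2 ≤ M.maxMatches)
    (q : BalancedState D S) (e : D × S) :
    ∃ q' ∈ M.afterMatch (arrive q e), ∑ k, (q'.1 k : ℝ) ^ 2 ≤ ∑ k, (q.1 k : ℝ) ^ 2 +
      2 * (M.demandDrift q.1 e.1 + M.supplyDrift q.1 e.2) + 4 := by
  obtain ⟨G, d, hG, hGc, hGl, hGr, hGd, hd1, hdq⟩ := M.exists_match_demand q.1 e.1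
  obtain ⟨G', d', hG', hGc', hGr', hGl', hGd', hd1', hdq'⟩ := M.exists_match_supply q.1 e.2
  -- The two matches do not compete: each uses one arriving item and one item already stored in `q`,
  -- on opposite sides.
  have hle : ((G + G').map pairVec).sum ≤ (arrive q e).1 := by
    rintro (k | k)
    · have h1 := hGl k
      have h2 := hGl' k
      simp only [Multiset.map_add, Multiset.sum_add, arrive, pairVec, Pi.add_apply]
      omega
    · have h1 := hGr k
      have h2 := hGr' k
      simp only [Multiset.map_add, Multiset.sum_add, arrive, pairVec, Pi.add_apply]
      omega
  have hmem := M.sum_map_pairVec_mem_inputSpace (G + G')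
    (fun e he => (Multiset.mem_add.1 he).elim (hG e) (hG' e)) (by rw [Multiset.card_add]; omega)
  refine ⟨_, mem_afterMatch.2 ⟨⟨_, hmem, hle⟩, rfl⟩, ?_⟩
  have hval : ∀ k, (((M.remove (arrive q e) ⟨_, hmem, hle⟩).1 k : ℕ) : ℝ) =
      q.1 k + d k + d' k := fun k => by
    simp only [remove]
    rw [Nat.cast_sub (hle k)]
    simp only [Multiset.map_add, Multiset.sum_add, arrive, pairVec, Pi.add_apply, Nat.cast_add,
      hGd, hGd']
    ring
  -- The new level is `q + d + d'`, and `(d + d') ^ 2 ≤ 2 * d ^ 2 + 2 * d' ^ 2` sums to the constant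
  -- 4.
  rw [← hdq, ← hdq', ← Finset.sum_add_distrib, Finset.mul_sum, ← Finset.sum_add_distrib,
    show (4 : ℝ) = ∑ k, (2 * d k ^ 2 + 2 * d' k ^ 2) by
      rw [Finset.sum_add_distrib, ← Finset.mul_sum, ← Finset.mul_sum, hd1, hd1']; norm_num,
    ← Finset.sum_add_distrib]
  refine Finset.sum_le_sum fun k _ => ?_
  rw [hval]
  nlinarith [sq_nonneg (d k - d' k)]

/-- The matching model has a quadratic Lyapunov function for the longest-neighbor policy. -/
theorem exists_lyapunov (M : MatchingModel D S) (hconn : M.graph.Connected)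
    (hmax : 2 ≤ M.maxMatches) (hcost : ∀ k, 0 < M.c k) (hN : M.NCond) :
    ∃ (w : BalancedState D S → ℝ) (K : ℝ)
      (s : BalancedState D S → {e // e ∈ M.arrivals} → BalancedState D S),
      (∀ q, 0 ≤ w q) ∧ 0 ≤ K ∧ (∀ q e, s q e ∈ M.afterMatch (arrive q e.1)) ∧
      ∀ q, ∑ e, (M.law e).toReal * w (s q e) ≤ w q - 2 * M.meanCost q + K := by
  obtain ⟨δ, hδ, hdrift⟩ := M.exists_negative_drift hconn hN
  choose s hs hs' using fun q (e : {e // e ∈ M.arrivals}) =>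
    M.exists_longest_neighbor_step hmax q e.1
  set c₁ := ∑ k, M.c k
  set c₀ := ∑ e, (M.law e).toReal * M.realCost (pairVec e.1)
  have hc₁ : 0 ≤ c₁ := Finset.sum_nonneg fun k _ => (hcost k).le
  have hc₀ : 0 ≤ c₀ := Finset.sum_nonneg fun e _ =>
    mul_nonneg ENNReal.toReal_nonneg (M.realCost_nonneg hcost _)
  -- The drift of `A * ∑ q ^ 2` is then at most `-4 * c₁` times the total demand, up to a constant.
  -- This dominates twice the linear cost because total demand is half of all items.
  set A := 2 * c₁ / δ with hA
  have hA0 : 0 ≤ A := by positivity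
  refine ⟨fun q => A * ∑ k, (q.1 k : ℝ) ^ 2, A * 4 + 2 * c₀, s, fun q => by positivity,
    by positivity, hs, fun q => ?_⟩
  have h1 : ∑ e, (M.law e).toReal * (A * ∑ k, ((s q e).1 k : ℝ) ^ 2) ≤
      ∑ e, (M.law e).toReal * (A * (∑ k, (q.1 k : ℝ) ^ 2 + 4)) +
        2 * A * (∑ e, (M.law e).toReal * M.demandDrift q.1 e.1.1 +
          ∑ e, (M.law e).toReal * M.supplyDrift q.1 e.1.2) := by
    rw [← Finset.sum_add_distrib, Finset.mul_sum, ← Finset.sum_add_distrib]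
    refine Finset.sum_le_sum fun e _ => ?_
    have := mul_le_mul_of_nonneg_left (mul_le_mul_of_nonneg_left (hs' q e) hA0)
      (ENNReal.toReal_nonneg (a := M.law e))
    linarith
  rw [← Finset.sum_mul, sum_law_toReal, one_mul, ← sum_rate_inl_mul, ← sum_rate_inr_mul] at h1
  have h2 := mul_le_mul_of_nonneg_left (hdrift q) hA0
  have h3 : A * (δ * ∑ i, (q.1 (Sum.inl i) : ℝ)) = 2 * c₁ * ∑ i, (q.1 (Sum.inl i) : ℝ) := by
    rw [hA]; field_simp
  have h4 : M.realCost q.1 ≤ c₁ * (2 * ∑ i, (q.1 (Sum.inl i) : ℝ)) := by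
    have h5 : ∑ k, (q.1 k : ℝ) = 2 * ∑ i, (q.1 (Sum.inl i) : ℝ) := by
      have hbal : ∑ j, (q.1 (Sum.inr j) : ℝ) = ∑ i, (q.1 (Sum.inl i) : ℝ) := by
        exact_mod_cast q.2.symm
      rw [Fintype.sum_sum_type, hbal]; ring
    rw [← h5, Finset.mul_sum]
    exact Finset.sum_le_sum fun k _ => mul_le_mul_of_nonneg_right
      (Finset.single_le_sum (fun k _ => (hcost k).le) (Finset.mem_univ k)) (Nat.cast_nonneg _)
  rw [meanCost_eq]
  linarith

end MatchingModel

/-! ### Reachability in the matching model -/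

namespace MatchingModel

variable {D : Type u} {S : Type v} [Fintype D] [Fintype S] [DecidableEq D] [DecidableEq S]

theorem sum_inl_sum_map_pairVec (G : Multiset (D × S)) :
    ∑ i : D, (G.map pairVec).sum (Sum.inl i) = G.card := by
  induction G using Multiset.induction_on with
  | empty => simp
  | cons e G ih => simp [Finset.sum_add_distrib, ih, sum_inl_pairVec, add_comm]

theorem sum_inr_sum_map_pairVec (G : Multiset (D × S)) :
    ∑ j : S, (G.map pairVec).sum (Sum.inr j) = G.card := by
  induction G using Multiset.induction_on with
  | empty => simp
  | cons e G ih => simp [Finset.sum_add_distrib, ih, sum_inr_pairVec, add_comm]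

/-- Pairs that arrive with positive probability. -/
def IsArrival (M : MatchingModel D S) (e : D × S) : Prop :=
  ∃ h : e ∈ M.arrivals, M.law ⟨e, h⟩ ≠ 0

/-- A possible transition between buffer levels, for unbundled vectors. -/
def Step (M : MatchingModel D S) (f g : D ⊕ S → ℕ) : Prop :=
  ∃ a, M.IsArrival a ∧ ∃ G : Multiset (D × S), (∀ e ∈ G, e ∈ M.edges) ∧
    G.card ≤ M.maxMatches ∧ g + (G.map pairVec).sum = f + pairVec a

variable {M : MatchingModel D S}

theorem reach_lift {q : BalancedState D S} {g : D ⊕ S → ℕ}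
    (h : Relation.ReflTransGen M.Step q.1 g) :
    ∃ q' : BalancedState D S, q'.1 = g ∧ Relation.ReflTransGen (fun x y => ∃ a,
      0 < (M.law a).toReal ∧ y ∈ M.afterMatch (arrive x a.1)) q q' := by
  induction h with
  | refl => exact ⟨q, rfl, .refl⟩
  | tail _ hstep ih =>
    obtain ⟨x, rfl, hx⟩ := ih
    obtain ⟨a, ⟨ha, ha'⟩, G, hG, hGc, hsum⟩ := hstep
    have hle : (G.map pairVec).sum ≤ (arrive x a).1 := by
      change _ ≤ x.1 + pairVec a
      rw [← hsum]
      exact le_add_self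
    refine ⟨M.remove (arrive x a) ⟨_, M.sum_map_pairVec_mem_inputSpace G hG hGc, hle⟩, ?_,
      hx.tail ⟨⟨a, ha⟩, ENNReal.toReal_pos ha' (M.law.apply_ne_top _), mem_afterMatch.2 ⟨_, rfl⟩⟩⟩
    funext k
    have := congrFun hsum k
    simp only [remove, arrive, Pi.add_apply] at this ⊢
    omega

theorem reach_add_arrivals (F : Multiset (D × S)) (hF : ∀ e ∈ F, M.IsArrival e)
    (f : D ⊕ S → ℕ) : Relation.ReflTransGen M.Step f (f + (F.map pairVec).sum) := by
  induction F using Multiset.induction_on generalizing f with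
  | empty => simpa using Relation.ReflTransGen.refl
  | cons e F ih =>
    rw [Multiset.map_cons, Multiset.sum_cons, ← add_assoc]
    exact (ih (fun e he => hF e (Multiset.mem_cons_of_mem he)) _).head
      ⟨e, hF e (Multiset.mem_cons_self _ _), 0, by simp, by simp, by simp⟩

/-- Any vector can be reached from a vector that exceeds it by a given amount at least. -/
theorem exists_reach_remove (hmax : 3 ≤ M.maxMatches) {a : D × S} (ha : M.IsArrival a) {i : D}
    {j : S} (hi : (i, a.2) ∈ M.edges) (hj : (a.1, j) ∈ M.edges) (L : Multiset (D × S))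
    (hL : ∀ e ∈ L, e ∈ M.edges) (g : D ⊕ S → ℕ) :
    ∃ R : Multiset (D × S), Relation.ReflTransGen M.Step
      (g + (L.map pairVec).sum + (R.map pairVec).sum) g := by
  induction L using Multiset.induction_on with
  | empty => exact ⟨0, by simpa using Relation.ReflTransGen.refl⟩
  | cons e L ih =>
    obtain ⟨R, hR⟩ := ih fun e he => hL e (Multiset.mem_cons_of_mem he)
    -- The arriving pair need not be a matching pair, so its items are matched with `j` and `i` from
    -- the stock. Removing `e` thus takes three matches and consumes one spare pair `(i, j)`.
    refine ⟨(i, j) ::ₘ R, hR.head ⟨a, ha, {(a.1, j), (i, a.2), e}, ?_, ?_, ?_⟩⟩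
    · simpa [hi, hj] using hL e (Multiset.mem_cons_self _ _)
    · simpa using hmax
    · simp only [Multiset.insert_eq_cons, Multiset.map_cons, Multiset.map_singleton,
        Multiset.sum_cons, Multiset.sum_singleton, pairVec]
      abel

/-- One arrival and one match per slot exchange a stock of matching pairs for the arrivals of a
batch of the same length. -/
theorem reach_block (hmax : 1 ≤ M.maxMatches) (B E : List (D × S)) (hlen : B.length = E.length)
    (hB : ∀ e ∈ B, M.IsArrival e) (hE : ∀ e ∈ E, e ∈ M.edges) (f : D ⊕ S → ℕ) :
    Relation.ReflTransGen M.Step (f + (E.map pairVec).sum) (f + (B.map pairVec).sum) := by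
  induction B generalizing E f with
  | nil =>
    rw [List.length_nil, eq_comm, List.length_eq_zero_iff] at hlen
    subst hlen
    exact .refl
  | cons b B ih =>
    cases E with
    | nil => simp at hlen
    | cons e E =>
      have h := ih E (by simpa using hlen) (fun x hx => hB x (List.mem_cons_of_mem _ hx))
        (fun x hx => hE x (List.mem_cons_of_mem _ hx)) (f + pairVec b)
      rw [List.map_cons (l := B), List.sum_cons, ← add_assoc]
      refine h.head ⟨b, hB b List.mem_cons_self, {e}, ?_, by simpa using hmax, ?_⟩
      · simpa using hE e List.mem_cons_self
      · simp only [Multiset.map_singleton, Multiset.sum_singleton, List.map_cons, List.sum_cons]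
        abel

/-- When the batch of arrivals has the same sum as the stock of matches, a round of `reach_block`
restores the stock. An extra match in the first slot of each round then removes one element of `G`.
-/
theorem reach_remove_matches (hmax : 2 ≤ M.maxMatches) {b e : D × S} {B E : List (D × S)}
    (hlen : B.length = E.length)
    (hB : ∀ x ∈ b :: B, M.IsArrival x) (hE : ∀ x ∈ e :: E, x ∈ M.edges)
    (hsum : ((b :: B).map pairVec).sum = ((e :: E).map pairVec).sum) (G : Multiset (D × S))
    (hG : ∀ e ∈ G, e ∈ M.edges) (f : D ⊕ S → ℕ) :
    Relation.ReflTransGen M.Step (f + ((e :: E).map pairVec).sum + (G.map pairVec).sum)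
      (f + ((e :: E).map pairVec).sum) := by
  induction G using Multiset.induction_on with
  | empty => simpa using Relation.ReflTransGen.refl
  | cons g G ih =>
    refine Relation.ReflTransGen.trans ?_ (ih fun x hx => hG x (Multiset.mem_cons_of_mem hx))
    have h := reach_block (M := M) (by omega) B E hlen
      (fun x hx => hB x (List.mem_cons_of_mem _ hx))
      (fun x hx => hE x (List.mem_cons_of_mem _ hx)) (f + (G.map pairVec).sum + pairVec b)
    rw [show f + ((e :: E).map pairVec).sum + (G.map pairVec).sum =
      f + (G.map pairVec).sum + pairVec b + (B.map pairVec).sum by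
        rw [← hsum, List.map_cons, List.sum_cons]; abel]
    refine h.head ⟨b, hB b List.mem_cons_self, {e, g}, ?_, by simpa using hmax, ?_⟩
    · have h1 := hE e List.mem_cons_self
      have h2 := hG g (Multiset.mem_cons_self _ _)
      simp [h1, h2]
    · simp only [Multiset.insert_eq_cons, Multiset.map_cons, Multiset.map_singleton,
        Multiset.sum_cons, Multiset.sum_singleton, List.map_cons, List.sum_cons]
      abel

theorem sum_sigma_fin_ite_eq {ι : Type*} [Fintype ι] [DecidableEq ι] (n : ι → ℕ) (i : ι) :
    (∑ x : (Σ k, Fin (n k)), if i = x.1 then 1 else 0) = n i := by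
  rw [Fintype.sum_sigma]
  rw [Finset.sum_eq_single i (fun k _ hk => by simp [hk.symm]) (by simp)]
  simp

/-- Hall's theorem: a vector that satisfies the marriage condition is a sum of matches. -/
theorem exists_sum_pairVec_eq (β : D ⊕ S → ℕ)
    (hbal : ∑ i, β (Sum.inl i) = ∑ j, β (Sum.inr j))
    (hHall : ∀ B : Finset D, ∑ i ∈ B, β (Sum.inl i) ≤ ∑ j ∈ M.supplyOf B, β (Sum.inr j)) :
    ∃ G : Multiset (D × S), (∀ e ∈ G, e ∈ M.edges) ∧ (G.map pairVec).sum = β := by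
  classical
  let t : (Σ i : D, Fin (β (Sum.inl i))) → Finset (Σ j : S, Fin (β (Sum.inr j))) := fun x =>
    (M.supplyNbrs x.1).sigma fun _ => Finset.univ
  obtain ⟨f, hf, hft⟩ := (Finset.all_card_le_biUnion_card_iff_exists_injective t).1 fun s => by
    have h1 : s.card ≤ ∑ i ∈ s.image Sigma.fst, β (Sum.inl i) := by
      have : s ⊆ (s.image Sigma.fst).sigma fun _ => Finset.univ := fun x hx => by
        simpa using ⟨x.2, hx⟩
      simpa using Finset.card_le_card this
    have h2 : s.biUnion t = (M.supplyOf (s.image Sigma.fst)).sigma fun _ => Finset.univ := by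
      ext ⟨j, y⟩
      simp [t, supplyOf, supplyNbrs]
    rw [h2]
    simpa using h1.trans (hHall _)
  -- Hall's theorem assigns distinct supply units to the demand units; by balance no supply unit is
  -- left over.
  have hbij : Function.Bijective f :=
    (Fintype.bijective_iff_injective_and_card f).2 ⟨hf, by simpa using hbal⟩
  refine ⟨Finset.univ.val.map fun x => (x.1, (f x).1), fun e he => ?_, ?_⟩
  · obtain ⟨x, -, rfl⟩ := Multiset.mem_map.1 he
    have := hft x
    simp only [t, supplyNbrs, Finset.mem_sigma, Finset.mem_filter] at this
    exact this.1.2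
  · rw [Multiset.map_map]
    change ∑ x, pairVec (x.1, (f x).1) = β
    funext k
    rw [Finset.sum_apply]
    rcases k with i | j
    · have h1 := sum_sigma_fin_ite_eq (fun i : D => β (Sum.inl i)) i
      simpa [pairVec, Pi.single_apply] using h1
    · have h1 := (hbij.sum_comp fun y : (Σ j : S, Fin (β (Sum.inr j))) =>
        if j = y.1 then 1 else 0).trans (sum_sigma_fin_ite_eq (fun j : S => β (Sum.inr j)) j)
      simpa [pairVec, Pi.single_apply] using h1

/-- Take about `T` times the law of each pair as arrivals `F`. For large `T` the slack in `NCond`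
outweighs `f`, `g` and the rounding, so `f + β - g`, with `β` the sum of `F`, satisfies Hall's
condition. -/
theorem exists_arrivals_eq_matches (hconn : M.graph.Connected) (hN : M.NCond)
    {f g : D ⊕ S → ℕ} (hf : ∑ i, f (Sum.inl i) = ∑ j, f (Sum.inr j))
    (hg : ∑ i, g (Sum.inl i) = ∑ j, g (Sum.inr j)) :
    ∃ F G : Multiset (D × S), (∀ e ∈ F, M.IsArrival e) ∧ (∀ e ∈ G, e ∈ M.edges) ∧
      f + (F.map pairVec).sum = g + (G.map pairVec).sum := by
  obtain ⟨hD, hS⟩ := M.nonempty_classes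
  obtain ⟨-, hedge⟩ := M.exists_edge_of_connected hconn
  obtain ⟨ε, hε, hslack⟩ := M.exists_slack hN
  obtain ⟨ρ, hρ, hrate⟩ := Finset.exists_pos_forall_le Finset.univ M.rate
    fun k _ => M.rate_pos hN k
  set n : ℝ := (Fintype.card {e // e ∈ M.arrivals} : ℝ) with hndef
  have hn : 0 ≤ n := Nat.cast_nonneg _
  -- Rounding down changes each class by at most `n`. The single `n` is for `g ≤ f + β` and the
  -- multiple `Fintype.card S * n` for Hall's condition on a set of supply classes.
  set C : ℝ := ∑ k, (f k : ℝ) + ∑ k, (g k : ℝ) + n + Fintype.card S * n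
  have hf0 : 0 ≤ ∑ k, (f k : ℝ) := Finset.sum_nonneg fun _ _ => Nat.cast_nonneg _
  have hg0 : 0 ≤ ∑ k, (g k : ℝ) := Finset.sum_nonneg fun _ _ => Nat.cast_nonneg _
  have hSn : 0 ≤ Fintype.card S * n := by positivity
  obtain ⟨T, hT⟩ := exists_nat_ge (C / min ε ρ)
  rw [div_le_iff₀ (lt_min hε hρ)] at hT
  have hTε : C ≤ T * ε := hT.trans (mul_le_mul_of_nonneg_left (min_le_left _ _) T.cast_nonneg)
  have hTρ : C ≤ T * ρ := hT.trans (mul_le_mul_of_nonneg_left (min_le_right _ _) T.cast_nonneg)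
  let m : {e // e ∈ M.arrivals} → ℕ := fun e => ⌊T * (M.law e).toReal⌋₊
  let F : Multiset (D × S) := ∑ e, Multiset.replicate (m e) e.1
  have hFsum : (F.map pairVec).sum = ∑ e, m e • pairVec e.1 := by
    have := map_sum (Multiset.sumAddMonoidHom.comp (Multiset.mapAddMonoidHom
      (pairVec : D × S → D ⊕ S → ℕ))) (fun e => Multiset.replicate (m e) e.1)
      (Finset.univ : Finset {e // e ∈ M.arrivals})
    refine this.trans (Finset.sum_congr rfl fun e _ => ?_)
    change ((Multiset.replicate (m e) e.1).map pairVec).sum = _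
    rw [Multiset.map_replicate, Multiset.sum_replicate]
  have hFarr : ∀ e ∈ F, M.IsArrival e := fun e he => by
    obtain ⟨a, -, ha⟩ := Multiset.mem_sum.1 he
    rw [Multiset.mem_replicate] at ha
    refine ⟨ha.2 ▸ a.2, fun h => ha.1 ?_⟩
    have h' : M.law a = 0 := by rw [← h]; congr 1; exact Subtype.ext ha.2.symm
    simp [m, h']
  set β : D ⊕ S → ℕ := (F.map pairVec).sum with hβ
  have hβval : ∀ k, (β k : ℝ) = ∑ e, (m e : ℝ) * (pairVec e.1 k : ℝ) := fun k => by
    rw [hFsum, Finset.sum_apply]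
    simp
  have hpv : ∀ (e : D × S) k, (pairVec e k : ℝ) ≤ 1 := fun e k => by
    rcases k with k | k
    · simp only [pairVec, Pi.add_apply, Pi.single_apply]
      simp
      split_ifs <;> simp
    · simp only [pairVec, Pi.add_apply, Pi.single_apply]
      simp
      split_ifs <;> simp
  have hup : ∀ k, (β k : ℝ) ≤ T * M.rate k := fun k => by
    rw [hβval, rate, Finset.mul_sum]
    refine Finset.sum_le_sum fun e _ => ?_
    rw [← mul_assoc]
    exact mul_le_mul_of_nonneg_right (Nat.floor_le (by positivity)) (Nat.cast_nonneg _)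
  have hlo : ∀ k, T * M.rate k - n ≤ β k := fun k => by
    rw [hβval, rate, Finset.mul_sum, sub_le_iff_le_add]
    have : n = ∑ e : {e // e ∈ M.arrivals}, (1 : ℝ) := by simp [hndef]
    rw [this, ← Finset.sum_add_distrib]
    refine Finset.sum_le_sum fun e _ => ?_
    have h1 := Nat.lt_floor_add_one (T * (M.law e).toReal)
    have h2 := hpv e.1 k
    have h3 : (0 : ℝ) ≤ pairVec e.1 k := Nat.cast_nonneg _
    simp only [m]
    nlinarith
  have hgle : ∀ k, g k ≤ f k + β k := fun k => by
    have h1 := mul_le_mul_of_nonneg_left (hrate k (Finset.mem_univ k)) (T.cast_nonneg (α := ℝ))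
    have h2 : (g k : ℝ) ≤ ∑ k, (g k : ℝ) :=
      Finset.single_le_sum (f := fun k => (g k : ℝ)) (fun _ _ => Nat.cast_nonneg _)
        (Finset.mem_univ k)
    have h3 : (g k : ℝ) ≤ β k := by linarith [hlo k]
    exact (Nat.cast_le.1 h3).trans (Nat.le_add_left _ _)
  have hbalF : ∑ i, β (Sum.inl i) = ∑ j, β (Sum.inr j) := by
    rw [hβ, sum_inl_sum_map_pairVec, sum_inr_sum_map_pairVec]
  have hbal : ∑ i, (f (Sum.inl i) + β (Sum.inl i) - g (Sum.inl i)) =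
      ∑ j, (f (Sum.inr j) + β (Sum.inr j) - g (Sum.inr j)) := by
    rw [Finset.sum_tsub_distrib _ (fun i _ => hgle (Sum.inl i)),
      Finset.sum_tsub_distrib _ (fun i _ => hgle (Sum.inr i)), Finset.sum_add_distrib,
      Finset.sum_add_distrib, hf, hg, hbalF]
  obtain ⟨G, hG, hGsum⟩ := exists_sum_pairVec_eq (M := M) (fun k => f k + β k - g k) hbal
    fun B => by
      rcases B.eq_empty_or_nonempty with rfl | hB
      · simp
      by_cases hB' : B = Finset.univ
      · have : M.supplyOf B = Finset.univ := by
          ext j; simpa [hB', supplyOf] using hedge j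
        rw [this, hB', hbal]
      have h1 := hslack B hB hB'
      have h2 : ∑ i ∈ B, ((f (Sum.inl i) + β (Sum.inl i) - g (Sum.inl i) : ℕ) : ℝ) ≤
          ∑ k, (f k : ℝ) + T * ∑ i ∈ B, M.rate (Sum.inl i) := by
        have h3 : ∑ i ∈ B, (f (Sum.inl i) : ℝ) ≤ ∑ k, (f k : ℝ) := by
          rw [Fintype.sum_sum_type]
          exact (Finset.sum_le_sum_of_subset_of_nonneg (Finset.subset_univ B)
            fun _ _ _ => Nat.cast_nonneg _).trans
            (le_add_of_nonneg_right (Finset.sum_nonneg fun _ _ => Nat.cast_nonneg _))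
        refine le_trans ?_ (add_le_add_left h3 _)
        rw [Finset.mul_sum, ← Finset.sum_add_distrib]
        refine Finset.sum_le_sum fun i _ => ?_
        rw [Nat.cast_sub (hgle _), Nat.cast_add]
        linarith [hup (Sum.inl i), Nat.cast_nonneg (α := ℝ) (g (Sum.inl i))]
      have h4 : T * ∑ j ∈ M.supplyOf B, M.rate (Sum.inr j) - Fintype.card S * n - ∑ k, (g k : ℝ) ≤
          ∑ j ∈ M.supplyOf B, ((f (Sum.inr j) + β (Sum.inr j) - g (Sum.inr j) : ℕ) : ℝ) := by
        have h5 : ∑ j ∈ M.supplyOf B, ((g (Sum.inr j) : ℝ) + n) ≤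
            ∑ k, (g k : ℝ) + Fintype.card S * n := by
          refine (Finset.sum_le_sum_of_subset_of_nonneg (Finset.subset_univ _)
            fun _ _ _ => by positivity).trans ?_
          rw [Finset.sum_add_distrib, Fintype.sum_sum_type, Finset.sum_const, Finset.card_univ,
            nsmul_eq_mul]
          gcongr
          exact le_add_of_nonneg_left (Finset.sum_nonneg fun _ _ => Nat.cast_nonneg _)
        have h6 : ∑ j ∈ M.supplyOf B, (T * M.rate (Sum.inr j) - ((g (Sum.inr j) : ℝ) + n)) ≤
            ∑ j ∈ M.supplyOf B, ((f (Sum.inr j) + β (Sum.inr j) - g (Sum.inr j) : ℕ) : ℝ) := by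
          refine Finset.sum_le_sum fun j _ => ?_
          rw [Nat.cast_sub (hgle _), Nat.cast_add]
          linarith [hlo (Sum.inr j), Nat.cast_nonneg (α := ℝ) (f (Sum.inr j))]
        rw [Finset.sum_sub_distrib, ← Finset.mul_sum] at h6
        linarith
      have h7 := mul_le_mul_of_nonneg_left h1 (T.cast_nonneg (α := ℝ))
      have h8 : ∑ i ∈ B, ((f (Sum.inl i) + β (Sum.inl i) - g (Sum.inl i) : ℕ) : ℝ) ≤
          ∑ j ∈ M.supplyOf B, ((f (Sum.inr j) + β (Sum.inr j) - g (Sum.inr j) : ℕ) : ℝ) := by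
        linarith
      exact_mod_cast h8
  refine ⟨F, G, hFarr, hG, ?_⟩
  rw [hGsum]
  funext k
  have := hgle k
  simp only [Pi.add_apply]
  rw [Nat.add_sub_cancel' this]

/-- Placing one matching pair in the target `g` makes the block nonempty; balance equates the two
lengths. -/
theorem exists_balanced_block (hconn : M.graph.Connected) (hN : M.NCond) :
    ∃ (b e : D × S) (B E : List (D × S)), B.length = E.length ∧
      (∀ x ∈ b :: B, M.IsArrival x) ∧ (∀ x ∈ e :: E, x ∈ M.edges) ∧
      ((b :: B).map pairVec).sum = ((e :: E).map pairVec).sum := by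
  obtain ⟨⟨i⟩, ⟨j₀⟩⟩ := M.nonempty_classes
  have : Nonempty D := ⟨i⟩
  have : Nonempty S := ⟨j₀⟩
  obtain ⟨j, hij⟩ := (M.exists_edge_of_connected hconn).1 i
  obtain ⟨F, G, hF, hG, hFG⟩ := exists_arrivals_eq_matches (M := M) hconn hN (f := 0)
    (g := pairVec (i, j)) (by simp) (by rw [sum_inl_pairVec, sum_inr_pairVec])
  have hFG' : (F.map pairVec).sum = (((i, j) ::ₘ G).map pairVec).sum := by
    simpa using hFG
  have hcard := congrArg (fun f : D ⊕ S → ℕ => ∑ i, f (Sum.inl i)) hFG'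
  simp only [sum_inl_sum_map_pairVec, Multiset.card_cons] at hcard
  obtain ⟨B, rfl⟩ := Quot.exists_rep F
  obtain ⟨E, rfl⟩ := Quot.exists_rep G
  cases B with
  | nil => simp at hcard
  | cons b B =>
    refine ⟨b, (i, j), B, E, by simpa using hcard, fun x hx => hF x (by simpa using hx),
      fun x hx => ?_, by simpa using hFG'⟩
    rcases List.mem_cons.1 hx with rfl | hx
    · exact hij
    · exact hG x (by simpa using hx)

/-- Every buffer level can be reached from every other one with positive probability. -/
theorem reachable (hconn : M.graph.Connected) (hmax : 3 ≤ M.maxMatches) (hN : M.NCond)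
    (q q' : BalancedState D S) :
    Relation.ReflTransGen (fun x y => ∃ a, 0 < (M.law a).toReal ∧
      y ∈ M.afterMatch (arrive x a.1)) q q' := by
  obtain ⟨hD, hS⟩ := M.nonempty_classes
  obtain ⟨hedge, hedge'⟩ := M.exists_edge_of_connected hconn
  obtain ⟨b, e, B, E, hlen, hB, hE, hsum⟩ := exists_balanced_block hconn hN
  obtain ⟨i, hi⟩ := hedge' b.2
  obtain ⟨j, hj⟩ := hedge b.1
  -- The route is built backwards from `q'`: it ends by removing the block `e :: E` with the help of
  -- spare pairs `R`. Before that the surplus `G` is cleared while the block is kept, and the route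
  -- starts by accumulating arrivals without matching.
  obtain ⟨R, hR⟩ := exists_reach_remove hmax (hB b List.mem_cons_self) hi hj
    ((e :: E : List (D × S)) : Multiset (D × S)) (fun x hx => hE x (by simpa using hx)) q'.1
  rw [Multiset.map_coe, Multiset.sum_coe, add_right_comm] at hR
  have hbal : ∑ i, (q'.1 + (R.map pairVec).sum + ((e :: E).map pairVec).sum) (Sum.inl i) =
      ∑ j, (q'.1 + (R.map pairVec).sum + ((e :: E).map pairVec).sum) (Sum.inr j) := by
    rw [← Multiset.sum_coe, ← Multiset.map_coe]
    simp only [Pi.add_apply, Finset.sum_add_distrib, sum_inl_sum_map_pairVec,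
      sum_inr_sum_map_pairVec, q'.2]
  obtain ⟨F, G, hF, hG, hFG⟩ := exists_arrivals_eq_matches hconn hN q.2 hbal
  have h1 := reach_add_arrivals F hF q.1
  rw [hFG] at h1
  have h2 := reach_remove_matches (by omega) hlen hB hE hsum G hG (q'.1 + (R.map pairVec).sum)
  obtain ⟨x, hx, hqx⟩ := reach_lift ((h1.trans h2).trans hR)
  rwa [Subtype.ext hx] at hqx

end MatchingModel

/-! ### Average cost optimality in the matching model -/

namespace MatchingModel

variable {D : Type u} {S : Type v} [Fintype D] [Fintype S] [DecidableEq D] [DecidableEq S]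

theorem linCost_eq (M : MatchingModel D S) (x : BalancedState D S) :
    M.linCost x = ENNReal.ofReal (M.realCost x.1) := rfl

/-- Discounted value iteration over the buffer levels, as a control problem with finite noise. -/
noncomputable def bufferIter (M : MatchingModel D S) (r : ℝ) : ℕ → BalancedState D S → ℝ :=
  FiniteControl.valueIter (fun e => (M.law e).toReal) (fun q e => M.afterMatch (arrive q e.1))
    (fun q e => M.afterMatch_nonempty (arrive q e.1)) M.meanCost r

/-- The finite-horizon discounted values as functions of the items present. -/
noncomputable def itemIter (M : MatchingModel D S) (r : ℝ) : ℕ → BalancedState D S → ℝ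
  | 0, _ => 0
  | n + 1, x => M.realCost x.1 +
      r * (M.afterMatch x).inf' (M.afterMatch_nonempty x) (M.bufferIter r n)

/-- The solution of the optimality equation as a function of the items present. -/
noncomputable def itemValue (M : MatchingModel D S) (h : BalancedState D S → ℝ)
    (x : BalancedState D S) : ℝ :=
  M.realCost x.1 + (M.afterMatch x).inf' (M.afterMatch_nonempty x) h

theorem bufferIter_nonneg (M : MatchingModel D S) (hcost : ∀ k, 0 < M.c k) {r : ℝ} (hr : 0 ≤ r)
    (n : ℕ) : 0 ≤ M.bufferIter r n :=
  FiniteControl.valueIter_nonneg (fun _ => ENNReal.toReal_nonneg) (M.meanCost_nonneg hcost) hr n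

theorem itemIter_nonneg (M : MatchingModel D S) (hcost : ∀ k, 0 < M.c k) {r : ℝ} (hr : 0 ≤ r)
    (n : ℕ) (x : BalancedState D S) : 0 ≤ M.itemIter r n x := by
  cases n with
  | zero => exact le_rfl
  | succ n =>
    exact add_nonneg (M.realCost_nonneg hcost _) (mul_nonneg hr
      (Finset.le_inf' _ _ fun q _ => M.bufferIter_nonneg hcost hr n q))

/-- Links the values before and after matching: averaging over the arrival takes the former to the
latter. -/
theorem sum_law_mul_itemIter (M : MatchingModel D S) (r : ℝ) (n : ℕ) (q : BalancedState D S) :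
    ∑ e, (M.law e).toReal * M.itemIter r n (arrive q e.1) = M.bufferIter r n q := by
  cases n with
  | zero => simp [itemIter, bufferIter, FiniteControl.valueIter]
  | succ n =>
    simp only [itemIter, mul_add, Finset.sum_add_distrib, bufferIter, FiniteControl.valueIter,
      FiniteControl.bellman, meanCost, Finset.mul_sum]
    congr 1
    exact Finset.sum_congr rfl fun e _ => by ring

theorem sum_law_mul_itemValue (M : MatchingModel D S) (h : BalancedState D S → ℝ)
    (q : BalancedState D S) :
    ∑ e, (M.law e).toReal * M.itemValue h (arrive q e.1) =
      FiniteControl.bellman (fun e => (M.law e).toReal) (fun q e => M.afterMatch (arrive q e.1))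
        (fun q e => M.afterMatch_nonempty (arrive q e.1)) M.meanCost 1 h q := by
  simp only [itemValue, mul_add, Finset.sum_add_distrib, FiniteControl.bellman, meanCost, one_mul]

theorem sum_law_mul_ofReal (M : MatchingModel D S) {F : BalancedState D S → ℝ}
    (hF : ∀ x, 0 ≤ F x) (q : BalancedState D S) :
    ∑ e, M.law e * ENNReal.ofReal (F (arrive q e.1)) =
      ENNReal.ofReal (∑ e, (M.law e).toReal * F (arrive q e.1)) := by
  rw [ENNReal.ofReal_sum_of_nonneg fun e _ => mul_nonneg ENNReal.toReal_nonneg (hF _)]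
  refine Finset.sum_congr rfl fun e _ => ?_
  rw [ENNReal.ofReal_mul ENNReal.toReal_nonneg, ENNReal.ofReal_toReal (M.law.apply_ne_top e)]

/-- Average cost optimality for every decision process whose state determines the items present,
with the cost and the transitions of the matching model. -/
theorem hasOptimalAverageCost_of_projection (M : MatchingModel D S) (hcost : ∀ k, 0 < M.c k)
    {η : ℝ≥0} {h : BalancedState D S → ℝ} (hh : 0 ≤ h)
    (hη : ∀ q, ∑ e, (M.law e).toReal * M.itemValue h (arrive q e.1) = η + h q)
    (hlow : ∀ (t : Finset (BalancedState D S)) (ht : t.Nonempty) (C η' : ℝ),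
      (∀ r : ℝ, 0 ≤ r → r < 1 → ∀ n,
        r * t.inf' ht (M.bufferIter r n) ≤ C + η' / (1 - r)) → (η : ℝ) ≤ η')
    (P : MDP.{w}) (g : P.State → BalancedState D S) (hc : ∀ s, P.cost s = M.linCost (g s))
    (hact : ∀ s (a : P.Act s), ∃ q ∈ M.afterMatch (g s), ∀ F : BalancedState D S → ℝ≥0∞,
      ∑' y, P.trans s a y * F (g y) = ∑ e, M.law e * F (arrive q e.1))
    (hact' : ∀ s, ∀ q ∈ M.afterMatch (g s), ∃ a : P.Act s, ∀ F : BalancedState D S → ℝ≥0∞,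
      ∑' y, P.trans s a y * F (g y) = ∑ e, M.law e * F (arrive q e.1)) :
    P.HasOptimalAverageCost η := by
  have hvalue : ∀ x, 0 ≤ M.itemValue h x := fun x =>
    add_nonneg (M.realCost_nonneg hcost _) (Finset.le_inf' _ _ fun q _ => hh q)
  have hchoice : ∀ s, ∃ a : P.Act s, P.cost s + ∑' y, P.trans s a y *
      ENNReal.ofReal (M.itemValue h (g y)) ≤ η + ENNReal.ofReal (M.itemValue h (g s)) := fun s => by
    -- The input that reaches a minimizer of `h` attains equality in the optimality equation.
    obtain ⟨q, hq, hmin⟩ := Finset.exists_mem_eq_inf' (M.afterMatch_nonempty (g s)) h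
    obtain ⟨a, ha⟩ := hact' s q hq
    refine ⟨a, ?_⟩
    rw [ha fun x => ENNReal.ofReal (M.itemValue h x), M.sum_law_mul_ofReal hvalue, hη, hc, linCost_eq,
      ← ENNReal.ofReal_add (M.realCost_nonneg hcost (g s).1) (add_nonneg η.coe_nonneg (hh q)),
      ← ENNReal.ofReal_coe_nnreal, ← ENNReal.ofReal_add η.coe_nonneg (hvalue _)]
    refine ENNReal.ofReal_le_ofReal (le_of_eq ?_)
    rw [itemValue, hmin]
    ring
  choose φ hφ using hchoice
  refine MDP.hasOptimalAverageCost_of_discounted (φ := φ)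
    (H := fun s => ENNReal.ofReal (M.itemValue h (g s))) (fun s => ENNReal.ofReal_ne_top) hφ
    (f := fun r n s => M.itemIter r n (g s)) (fun _ _ => rfl) (fun r hr hr1 n s a => ?_)
    (fun s C η' hC => ?_)
  · obtain ⟨q, hq, hF⟩ := hact s a
    rw [hF fun x => ENNReal.ofReal (M.itemIter r n x),
      M.sum_law_mul_ofReal (M.itemIter_nonneg hcost hr n), sum_law_mul_itemIter,
      ← ENNReal.ofReal_mul hr, hc, linCost_eq, ← ENNReal.ofReal_add (M.realCost_nonneg hcost _)
        (mul_nonneg hr (M.bufferIter_nonneg hcost hr n q))]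
    refine ENNReal.ofReal_le_ofReal ?_
    rw [itemIter]
    gcongr
    exact Finset.inf'_le _ hq
  · refine NNReal.coe_le_coe.1 (hlow _ (M.afterMatch_nonempty (g s)) C η' fun r hr hr1 n => ?_)
    -- One more step of `itemIter` exposes `r` times the minimum of `bufferIter r n` over the
    -- matches from the initial items; the initial cost is dropped.
    have := hC r hr hr1 (n + 1)
    rw [itemIter] at this
    linarith [M.realCost_nonneg hcost (g s).1]

end MatchingModel

theorem propositiont {D : Type u} {S : Type v} [Fintype D] [Fintype S] [DecidableEq D]
    [DecidableEq S] (M : MatchingModel D S)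
    (hconn : M.graph.Connected)
    (hmax : 4 ≤ M.maxMatches)
    (hcost : ∀ k, 0 < M.c k)
    (hN : M.NCond) :
    ∃ ηY ηX : ℝ≥0,
      M.mdpY.HasOptimalAverageCost ηY ∧ M.mdpX.HasOptimalAverageCost ηX ∧ ηY = ηX := by
  have : Nonempty (BalancedState D S) := ⟨⟨0, by simp⟩⟩
  obtain ⟨w, K, s, hw, hK, hs, hdrift⟩ := M.exists_lyapunov hconn (by omega) hcost hN
  obtain ⟨η, h, hη0, hh, hη, hlow⟩ := FiniteControl.exists_average_cost_optimality
    (p := fun e => (M.law e).toReal) (N := fun q e => M.afterMatch (MatchingModel.arrive q e.1))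
    (hN := fun q e => M.afterMatch_nonempty (MatchingModel.arrive q e.1)) (κ := M.meanCost)
    (fun _ => ENNReal.toReal_nonneg) M.sum_law_toReal (M.meanCost_nonneg hcost)
    (M.finite_meanCost_le hcost) hw hK hs hdrift
    (MatchingModel.reachable hconn (by omega) hN)
  lift η to ℝ≥0 using hη0
  simp only [← MatchingModel.sum_law_mul_itemValue] at hη
  -- The same `η` and `h` serve both processes: the items present are `arrive q a` for the state
  -- `(q, a)` of `Y`, and the state itself for `X`.
  refine ⟨η, η, ?_, ?_, rfl⟩
  · refine M.hasOptimalAverageCost_of_projection hcost hh hη hlow M.mdpY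
      (fun y => MatchingModel.arrive y.1 y.2.1) (fun _ => rfl) (fun y a => ?_) (fun y q hq => ?_)
    · refine ⟨_, MatchingModel.mem_afterMatch.2 ⟨a, rfl⟩, fun F => ?_⟩
      exact (PMF.tsum_map_mul _ _ _).trans (tsum_fintype _)
    · obtain ⟨a, rfl⟩ := MatchingModel.mem_afterMatch.1 hq
      exact ⟨a, fun F => (PMF.tsum_map_mul _ _ _).trans (tsum_fintype _)⟩
  · refine M.hasOptimalAverageCost_of_projection hcost hh hη hlow M.mdpX
      (fun x => x) (fun _ => rfl) (fun x a => ?_) (fun x q hq => ?_)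
    · refine ⟨_, MatchingModel.mem_afterMatch.2 ⟨a, rfl⟩, fun F => ?_⟩
      exact (PMF.tsum_map_mul _ _ _).trans (tsum_fintype _)
    · obtain ⟨a, rfl⟩ := MatchingModel.mem_afterMatch.1 hq
      exact ⟨a, fun F => (PMF.tsum_map_mul _ _ _).trans (tsum_fintype _)⟩
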